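/- Let $\omega>0$ and $\beta\in\mathbb R$. Let $H_0^{(1)}=J_0+iY_0$ be the Hankel function of the first kind of order zero, let $T_n$ be the Chebyshev polynomials of the first kind, and put $$I^{(1)}_{\omega,\beta}[g]=\int_0^1 g(x)H_0^{(1)}(\omega x)e^{i\omega\beta x}\,dx,\qquad \rho_n=I^{(1)}_{\omega,\beta}[x^n],\qquad \sigma_n=I^{(1)}_{\omega,\beta}[T_n(2x-1)].$$ Let $f_\beta(t)=\dfrac{1}{\sqrt{2i-t}\,(1+\beta+it)}$ for $t>0$. Square roots and powers are principal, $\tanh^{-1}z=\frac12\operatorname{Log}\frac{1+z}{1-z}$ with the principal logarithm (so $\tanh^{-1}x=\frac12\log\frac{x+1}{x-1}+\frac{i\pi}{2}$ for real $x>1$), and $\Theta_\beta=\tanh^{-1}\!\Big(\sqrt{\tfrac{\beta-1}{\beta+1}}\Big)$. For $\beta\ne-1$ and a function $F$ of $t$ write $\mathcal E[F]=i\omega^{-1/2}e^{i(\beta+1)\omega}\int_0^\infty F(t)\,t^{-1/2}e^{-t}\,dt$, and write $\partial^k_\beta f_\beta(t/\omega)$ for the $k$-th partial derivative in $\beta$.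 Then all integrals below converge absolutely, as do those defining $\rho_n$ for every $n\ge 0$ (for $\beta\neq-1$, the integrals of $\partial_\beta^k f_\beta(t/\omega)t^{-1/2}e^{-t}$ converge absolutely for each $k=0,1,2,3$), and the following hold. **Order 0.** $\rho_0=\sigma_0$. If $\beta\neq-1$, $$\rho_0=-\frac{2}{\pi\omega}\Big(\mathcal E[f_\beta(t/\omega)]+e_0\Big),\qquad e_0=\begin{cases}-\frac{2\Theta_\beta}{\sqrt{\beta^2-1}},&\beta>-1,\ \beta\ne1\\ -1,&\beta=1\\ \frac{2\Theta_\beta}{\sqrt{\beta^2-1}},&\beta<-1;\end{cases}$$ if $\beta=-1$, $$\rho_0=-\frac{2}{\pi\omega}\Big(i\omega^{1/2}\int_0^\infty\sqrt{2i-t/\omega}\;t^{-1/2}e^{-t}\,dt+1\Big).$$ **Order 1.** If $\beta\neq-1$, $$i\omega\rho_1=-\frac{2}{\pi\omega}\Big(\mathcal E\big[i\omega f_\beta(t/\omega)+\partial_\beta f_\beta(t/\omega)\big]+e_1\Big),\qquad e_1=\begin{cases}\frac1{1-\beta^2}+\frac{2\beta\Theta_\beta}{(\beta^2-1)^{3/2}},&\beta>-1,\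 \beta\ne1\\ \frac13,&\beta=1\\ \frac1{1-\beta^2}-\frac{2\beta\Theta_\beta}{(\beta^2-1)^{3/2}},&\beta<-1;\end{cases}$$ if $\beta=-1$, $$i\omega\rho_1=-\frac{2}{\pi\omega}\Big(-\frac i3\omega^{3/2}\int_0^\infty(-i-t/\omega)\sqrt{2i-t/\omega}\;t^{-1/2}e^{-t}\,dt+\frac13\Big).$$ **Order 2.** If $\beta\neq-1$, $$-\omega^2\rho_2=-\frac{2}{\pi\omega}\Big(\mathcal E\big[-\omega^2 f_\beta(t/\omega)+2i\omega\,\partial_\beta f_\beta(t/\omega)+\partial_\beta^2 f_\beta(t/\omega)\big]+e_2\Big),$$ $$e_2=\begin{cases}\frac{3\beta}{(\beta^2-1)^2}-\frac{(4\beta^2+2)\Theta_\beta}{(\beta^2-1)^{5/2}},&\beta>-1,\ \beta\ne1\\ -\frac4{15},&\beta=1\\ \frac{3\beta}{(\beta^2-1)^2}+\frac{(4\beta^2+2)\Theta_\beta}{(\beta^2-1)^{5/2}},&\beta<-1;\end{cases}$$ if $\beta=-1$, $$-\omega^2\rho_2=-\frac{2}{\pi\omega}\Big(\frac{i}{15}\omega^{5/2}\int_0^\infty\sqrt{2i-t/\omega}\,\big(2(t/\omega)^2+2it/\omega-3\big)\,t^{-1/2}e^{-t}\,dt+\frac4{15}\Big).$$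 **Order 3.** If $\beta\neq\pm1$, $$-i\omega^3\rho_3=-\frac{2}{\pi\omega}\,\mathcal E\big[-i\omega^3 f_\beta(t/\omega)-3\omega^2\partial_\beta f_\beta(t/\omega)+3i\omega\,\partial_\beta^2 f_\beta(t/\omega)+\partial_\beta^3 f_\beta(t/\omega)\big]+\frac{2}{\pi\omega}e_3,$$ $$e_3=\begin{cases}\frac{11\beta^2+4}{(\beta^2-1)^3}-\frac{6\beta(2\beta^2+3)\Theta_\beta}{(\beta^2-1)^{7/2}},&\beta>-1,\ \beta\neq1\\ \frac{11\beta^2+4}{(\beta^2-1)^3}+\frac{6\beta(2\beta^2+3)\Theta_\beta}{(\beta^2-1)^{7/2}},&\beta<-1.\end{cases}$$ **Chebyshev moments.** $\sigma_0=\rho_0$, $\sigma_1=2\rho_1-\rho_0$, $\sigma_2=8\rho_2-8\rho_1+\rho_0$, $\sigma_3=32\rho_3-48\rho_2+18\rho_1-\rho_0$. -/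

import Mathlib

open MeasureTheory Set Complex

noncomputable section

namespace HankelMoments

/-- Bessel function of the first kind of order zero,
`J₀(x) = ∑ (-1)^k / (k!)² (x/2)^(2k)`. -/
def besselJ0 (x : ℝ) : ℝ :=
  ∑' k : ℕ, (-1 : ℝ) ^ k / ((k.factorial : ℝ) ^ 2) * (x / 2) ^ (2 * k)

/-- Bessel function of the second kind of order zero, for `x > 0`:
`Y₀(x) = (2/π) (log (x/2) + γ) J₀(x) - (2/π) ∑ (-1)^k H_k / (k!)² (x/2)^(2k)`,
with `γ` the Euler-Mascheroni constant and `H_k = 1 + 1/2 + ... + 1/k`. -/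
def besselY0 (x : ℝ) : ℝ :=
  2 / Real.pi * (Real.log (x / 2) + Real.eulerMascheroniConstant) * besselJ0 x
    - 2 / Real.pi *
      ∑' k : ℕ, (-1 : ℝ) ^ k * ((harmonic k : ℚ) : ℝ) / ((k.factorial : ℝ) ^ 2)
        * (x / 2) ^ (2 * k)

/-- Hankel function of the first kind of order zero, `H₀⁽¹⁾ = J₀ + i Y₀`, on `x > 0`. -/
def hankelH10 (x : ℝ) : ℂ := (besselJ0 x : ℂ) + I * (besselY0 x : ℂ)

/-- The integrand `g(x) H₀⁽¹⁾(ω x) e^{i ω β x}`. -/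
def momentIntegrand (ω β : ℝ) (g : ℝ → ℂ) (x : ℝ) : ℂ :=
  g x * hankelH10 (ω * x) * exp (I * ω * β * x)

/-- The functional `I⁽¹⁾_{ω,β}[g] = ∫₀¹ g(x) H₀⁽¹⁾(ω x) e^{i ω β x} dx`. -/
def hankelIntegral (ω β : ℝ) (g : ℝ → ℂ) : ℂ :=
  ∫ x in (0 : ℝ)..1, momentIntegrand ω β g x

/-- Standard moments `ρ_n = I⁽¹⁾_{ω,β}[xⁿ]`. -/
def rho (ω β : ℝ) (n : ℕ) : ℂ := hankelIntegral ω β (fun x => (x : ℂ) ^ n)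

/-- Chebyshev moments `σ_n = I⁽¹⁾_{ω,β}[T_n(2x - 1)]`. -/
def sigma (ω β : ℝ) (n : ℕ) : ℂ :=
  hankelIntegral ω β
    (fun x => (((Polynomial.Chebyshev.T ℝ (n : ℤ)).eval (2 * x - 1) : ℝ) : ℂ))

/-- `f_β(t) = 1 / (√(2i - t) (1 + β + i t))`, with the principal square root. -/
def fBeta (β t : ℝ) : ℂ := 1 / (Complex.sqrt (2 * I - t) * (1 + β + I * t))

/-- The `k`-th partial derivative `∂_β^k f_β(t)`. -/
def fBetaDeriv (k : ℕ) (β t : ℝ) : ℂ := iteratedDeriv k (fun b : ℝ => fBeta b t) β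

/-- The integrand `g(t) t^{-1/2} e^{-t}`. -/
def decayIntegrand (g : ℝ → ℂ) (t : ℝ) : ℂ :=
  g t * (1 / ((√t : ℝ) : ℂ)) * exp (-(t : ℂ))

/-- The exponentially decaying integral `∫₀^∞ g(t) t^{-1/2} e^{-t} dt`. -/
def decayIntegral (g : ℝ → ℂ) : ℂ := ∫ t in Ioi (0 : ℝ), decayIntegrand g t

/-- Principal inverse hyperbolic tangent `tanh⁻¹ z = (1/2) Log ((1 + z) / (1 - z))`.
On the cut `z = x > 1` its value is `(1/2) log ((x + 1) / (x - 1)) + i π / 2`. -/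
def artanhC (z : ℂ) : ℂ := 1 / 2 * Complex.log ((1 + z) / (1 - z))

/-- `tanh⁻¹ √((β - 1) / (β + 1))`. -/
def artanhTerm (β : ℝ) : ℂ := artanhC (Complex.sqrt (((β : ℂ) - 1) / ((β : ℂ) + 1)))

/-- Elementary term in `ρ_0`, for `β ≠ -1`. -/
def elem0 (β : ℝ) : ℂ :=
  if β = 1 then -1
  else if -1 < β then -(2 * artanhTerm β / Complex.sqrt ((β : ℂ) ^ 2 - 1))
  else 2 * artanhTerm β / Complex.sqrt ((β : ℂ) ^ 2 - 1)

/-- Elementary term in `iω ρ_1`, for `β ≠ -1`. -/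
def elem1 (β : ℝ) : ℂ :=
  if β = 1 then 1 / 3
  else if -1 < β then
    1 / (1 - (β : ℂ) ^ 2) + 2 * β * artanhTerm β / ((β : ℂ) ^ 2 - 1) ^ (3 / 2 : ℂ)
  else
    1 / (1 - (β : ℂ) ^ 2) - 2 * β * artanhTerm β / ((β : ℂ) ^ 2 - 1) ^ (3 / 2 : ℂ)

/-- Elementary term in `-ω² ρ_2`, for `β ≠ -1`. -/
def elem2 (β : ℝ) : ℂ :=
  if β = 1 then -4 / 15
  else if -1 < β then
    3 * β / ((β : ℂ) ^ 2 - 1) ^ 2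
      - (4 * (β : ℂ) ^ 2 + 2) * artanhTerm β / ((β : ℂ) ^ 2 - 1) ^ (5 / 2 : ℂ)
  else
    3 * β / ((β : ℂ) ^ 2 - 1) ^ 2
      + (4 * (β : ℂ) ^ 2 + 2) * artanhTerm β / ((β : ℂ) ^ 2 - 1) ^ (5 / 2 : ℂ)

/-- Elementary term in `-iω³ ρ_3`, for `β ≠ ±1`. -/
def elem3 (β : ℝ) : ℂ :=
  if -1 < β then
    (11 * (β : ℂ) ^ 2 + 4) / ((β : ℂ) ^ 2 - 1) ^ 3
      - 6 * β * (2 * (β : ℂ) ^ 2 + 3) * artanhTerm β / ((β : ℂ) ^ 2 - 1) ^ (7 / 2 : ℂ)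
  else
    (11 * (β : ℂ) ^ 2 + 4) / ((β : ℂ) ^ 2 - 1) ^ 3
      + 6 * β * (2 * (β : ℂ) ^ 2 + 3) * artanhTerm β / ((β : ℂ) ^ 2 - 1) ^ (7 / 2 : ℂ)

end HankelMoments

end

/-! The engine is the Laplace representation H₀⁽¹⁾(x) = (2/π) ∫₀^∞ e^{(i-u)x} u^{-1/2} (2i-u)^{-1/2}
du for x > 0 (`hankelH10_eq`). Since H₀⁽¹⁾ is given by power series, this is an identification
problem. Both sides solve the Bessel equation of order zero, and both equal i log x + π/2 + i(γ -
log 2) + o(1) at the origin. Their difference is therefore a solution vanishing at 0⁺, and such a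
solution is zero, because it is a combination of J₀ and Y₀ (Wronskian) and Y₀ has a logarithm
(`IsBesselPair.eq_zero`).

Put L = 1 + β + iu. Fubini turns ρ_n into an integral over u of the kernel times ∫₀¹ xⁿ e^{iωLx} dx
(`rho_eq`). That inner moment is elementary: e^{iωL} times a polynomial in 1/L, minus a multiple of
L^{-(n+1)}. For β ≠ -1 the two pieces can be integrated separately (`pow_mul_rho_eq`). The first
decays like e^{-ωu} and, after t = ωu, is the integral with f_β and its β-derivatives. The second is
a multiple of the ω-free integral `kernelMoment β n` and yields the elementary term.

For the elementary terms, the variable v = i√u/√(2i-u) rationalizes the kernel. With κ² =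
(β-1)/(β+1), the function Log((1+κv)/(1-κv)) is then a primitive of a multiple of kernel/L, which
gives the inverse hyperbolic tangent (`kernelMoment_zero_eq`). All branches are principal because v
stays in the first quadrant and κ in its closure, so the argument of Log stays in the upper
half-plane. Differentiating √u √(2i-u)/L^{k+1} gives a recurrence that reaches the higher orders
(`kernelMoment_recurrence`). At β = 1 its leading coefficient vanishes and it determines the moments
outright.

For β = -1 one has L = iu and the separate pieces diverge at u = 0. There the inner moment is an
incomplete gamma function divided by (ωu)^{n+1}, and an integration by parts against an explicit
primitive of kernel/u^{n+1} leaves a convergent decaying integral plus a boundary term at infinity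
(`rho_neg_one_eq`). The Chebyshev moments follow by linearity. -/

namespace HankelMoments

open Filter Topology

/-! ### The square root √(2i - u) and the Laplace kernel -/

/-- The second fundamental theorem of calculus on `(0, ∞)`, with limits at both ends. -/
theorem integral_Ioi_eq_sub_of_tendsto {f f' : ℝ → ℂ} {A B : ℂ}
    (hderiv : ∀ u ∈ Ioi (0 : ℝ), HasDerivAt f (f' u) u) (hint : IntegrableOn f' (Ioi 0))
    (h0 : Tendsto f (𝓝[>] 0) (𝓝 A)) (h1 : Tendsto f atTop (𝓝 B)) :
    ∫ u in Ioi (0 : ℝ), f' u = B - A := by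
  have key := integral_Ioi_deriv_mul_eq_sub (u := fun _ => (1 : ℂ)) (u' := fun _ => 0) (v := f)
    (v' := f') (a := (0 : ℝ)) (a' := A) (b' := B) (fun x _ => hasDerivAt_const _ _) hderiv
    (by simpa [Pi.mul_def, Pi.add_def] using hint) (by simpa [Pi.mul_def] using h0)
    (by simpa [Pi.mul_def] using h1)
  simpa using key

/-- The principal square root `√(2i - u)`. -/
noncomputable def branchRoot (u : ℝ) : ℂ := Complex.sqrt (2 * I - u)

/-- The kernel `u^{-1/2} (2i - u)^{-1/2}` of the Laplace representation of `H₀⁽¹⁾`. -/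
noncomputable def hankelKernel (u : ℝ) : ℂ := 1 / ((√u : ℝ) * branchRoot u)

theorem branchRoot_sq (u : ℝ) : branchRoot u ^ 2 = 2 * I - u := by
  rw [branchRoot, Complex.sqrt, ← cpow_nat_mul]
  norm_num

theorem sq_sqrt (z : ℂ) : Complex.sqrt z ^ 2 = z := by
  rw [Complex.sqrt, ← cpow_nat_mul]
  norm_num

theorem norm_branchRoot_sq (u : ℝ) : ‖branchRoot u‖ ^ 2 = √(4 + u ^ 2) := by
  rw [← norm_pow, branchRoot_sq, Complex.norm_eq_sqrt_sq_add_sq]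
  congr 1
  simp
  ring

theorem two_le_norm_branchRoot_sq (u : ℝ) : 2 ≤ ‖branchRoot u‖ ^ 2 := by
  rw [norm_branchRoot_sq]
  exact Real.le_sqrt_of_sq_le (by nlinarith [sq_nonneg u])

theorem le_norm_branchRoot_sq (u : ℝ) : u ≤ ‖branchRoot u‖ ^ 2 := by
  rw [norm_branchRoot_sq]
  exact Real.le_sqrt_of_sq_le (by nlinarith)

theorem norm_branchRoot_sq_le {u : ℝ} (hu : 0 ≤ u) : ‖branchRoot u‖ ^ 2 ≤ 2 + u := by
  rw [norm_branchRoot_sq]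
  exact Real.sqrt_le_iff.2 ⟨by linarith, by nlinarith⟩

theorem one_le_norm_branchRoot (u : ℝ) : 1 ≤ ‖branchRoot u‖ := by
  nlinarith [two_le_norm_branchRoot_sq u, norm_nonneg (branchRoot u)]

theorem sqrt_le_norm_branchRoot (u : ℝ) : √u ≤ ‖branchRoot u‖ :=
  Real.sqrt_le_iff.2 ⟨norm_nonneg _, le_norm_branchRoot_sq u⟩

theorem norm_branchRoot_le {u : ℝ} (hu : 0 ≤ u) : ‖branchRoot u‖ ≤ 2 + u := by
  nlinarith [norm_branchRoot_sq_le hu, one_le_norm_branchRoot u]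

theorem branchRoot_ne_zero (u : ℝ) : branchRoot u ≠ 0 := by
  intro h
  have := one_le_norm_branchRoot u
  rw [h] at this
  norm_num at this

/-- The number 2i - u lies in the open upper half-plane, so its principal root lies in the open
first quadrant. The later branch choices rest on this location. -/
theorem branchRoot_re_pos (u : ℝ) : 0 < (branchRoot u).re := by
  rw [branchRoot, Complex.sqrt, cpow_inv_two_re]
  apply Real.sqrt_pos.2
  have h : |(2 * I - (u : ℂ)).re| < ‖2 * I - (u : ℂ)‖ := by
    rw [Complex.abs_re_lt_norm]; simp
  have := neg_abs_le (2 * I - (u : ℂ)).re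
  linarith

theorem branchRoot_im_pos (u : ℝ) : 0 < (branchRoot u).im := by
  rw [branchRoot, Complex.sqrt, cpow_inv_two_im_eq_sqrt (by simp)]
  apply Real.sqrt_pos.2
  have h : |(2 * I - (u : ℂ)).re| < ‖2 * I - (u : ℂ)‖ := by
    rw [Complex.abs_re_lt_norm]; simp
  have := le_abs_self (2 * I - (u : ℂ)).re
  linarith

theorem hasDerivAt_branchRoot (u : ℝ) :
    HasDerivAt branchRoot (-1 / (2 * branchRoot u)) u := by
  have hm : (2 * I - (u : ℂ)) ∈ slitPlane := by
    right; simp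
  have h1 : HasDerivAt (fun x : ℝ => 2 * I - (x : ℂ)) (-1) u := by
    simpa using (Complex.ofRealCLM.hasDerivAt (x := u)).const_sub (2 * I)
  have h2 := (Complex.hasDerivAt_sqrt hm).comp u h1
  refine h2.congr_deriv ?_
  rw [branchRoot, Complex.sqrt, show (-1 / 2 : ℂ) = -(2⁻¹) by norm_num, cpow_neg]
  ring

theorem continuous_branchRoot : Continuous branchRoot :=
  continuous_iff_continuousAt.2 fun u => (hasDerivAt_branchRoot u).continuousAt

theorem hasDerivAt_ofReal_sqrt {u : ℝ} (hu : 0 < u) :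
    HasDerivAt (fun x : ℝ => ((√x : ℝ) : ℂ)) (1 / (2 * (√u : ℝ))) u := by
  have := (Real.hasDerivAt_sqrt hu.ne').ofReal_comp
  simpa using this

theorem ofReal_sqrt_ne_zero {u : ℝ} (hu : 0 < u) : ((√u : ℝ) : ℂ) ≠ 0 := by
  exact_mod_cast (Real.sqrt_pos.2 hu).ne'

theorem ofReal_sqrt_sq {u : ℝ} (hu : 0 ≤ u) : ((√u : ℝ) : ℂ) ^ 2 = u := by
  exact_mod_cast Real.sq_sqrt hu

/-- The ratio `√(2i - u) / √u`. -/
noncomputable def rootRatio (u : ℝ) : ℂ := branchRoot u / (√u : ℝ)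

theorem rootRatio_sq {u : ℝ} (hu : 0 < u) : rootRatio u ^ 2 = 2 * I / u - 1 := by
  have : (u : ℂ) ≠ 0 := by exact_mod_cast hu.ne'
  rw [rootRatio, div_pow, branchRoot_sq, ofReal_sqrt_sq hu.le]
  field_simp

theorem rootRatio_im_pos {u : ℝ} (hu : 0 < u) : 0 < (rootRatio u).im := by
  rw [rootRatio, Complex.div_ofReal_im]
  exact div_pos (branchRoot_im_pos u) (Real.sqrt_pos.2 hu)

theorem rootRatio_re_pos {u : ℝ} (hu : 0 < u) : 0 < (rootRatio u).re := by
  rw [rootRatio, Complex.div_ofReal_re]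
  exact div_pos (branchRoot_re_pos u) (Real.sqrt_pos.2 hu)

theorem rootRatio_ne_zero {u : ℝ} (hu : 0 < u) : rootRatio u ≠ 0 :=
  div_ne_zero (branchRoot_ne_zero u) (ofReal_sqrt_ne_zero hu)

/-- The square r² = 2i/u - 1 fixes the limit only up to sign. Since Im r > 0, the factor |r + i| is
at least 1, so |r - i| |r + i| = 2/u forces r → i. -/
theorem tendsto_rootRatio : Tendsto rootRatio atTop (𝓝 I) := by
  rw [tendsto_iff_norm_sub_tendsto_zero]
  refine squeeze_zero' (g := fun u : ℝ => 2 / u) (.of_forall fun _ => norm_nonneg _) ?_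
    (tendsto_const_nhds.div_atTop tendsto_id)
  filter_upwards [eventually_gt_atTop 0] with u hu
  have him : 1 ≤ ‖rootRatio u + I‖ := by
    refine le_trans ?_ ((le_abs_self _).trans (Complex.abs_im_le_norm _))
    have := rootRatio_im_pos hu
    simp only [add_im, I_im]
    linarith
  have hmul : ‖rootRatio u - I‖ * ‖rootRatio u + I‖ = 2 / u := by
    rw [← norm_mul, show (rootRatio u - I) * (rootRatio u + I) = rootRatio u ^ 2 + 1 by
      linear_combination (-1 : ℂ) * I_sq, rootRatio_sq hu]
    simp [abs_of_pos hu]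
  nlinarith [norm_nonneg (rootRatio u - I)]

theorem norm_hankelKernel (u : ℝ) : ‖hankelKernel u‖ = 1 / (√u * ‖branchRoot u‖) := by
  rw [hankelKernel, norm_div, norm_mul, norm_one, Complex.norm_real, Real.norm_eq_abs,
    abs_of_nonneg (Real.sqrt_nonneg u)]

theorem continuousOn_hankelKernel : ContinuousOn hankelKernel (Ioi 0) := by
  unfold hankelKernel
  refine continuousOn_const.div ?_ fun u hu =>
    mul_ne_zero (ofReal_sqrt_ne_zero hu) (branchRoot_ne_zero u)
  have := continuous_branchRoot
  fun_prop

theorem norm_hankelKernel_le_rpow {u : ℝ} (hu : 0 < u) : ‖hankelKernel u‖ ≤ u ^ (-(1 / 2) : ℝ) := by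
  rw [norm_hankelKernel, Real.rpow_neg hu.le, ← Real.sqrt_eq_rpow, one_div]
  have h := Real.sqrt_pos.2 hu
  exact inv_anti₀ h (le_mul_of_one_le_right h.le (one_le_norm_branchRoot u))

theorem norm_hankelKernel_le_inv {u : ℝ} (hu : 0 < u) : ‖hankelKernel u‖ ≤ u⁻¹ := by
  rw [norm_hankelKernel, one_div]
  have h := Real.sqrt_pos.2 hu
  refine inv_anti₀ hu ?_
  calc u = √u * √u := (Real.mul_self_sqrt hu.le).symm
    _ ≤ _ := by gcongr; exact sqrt_le_norm_branchRoot u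

/-- A function dominated by `u^a` near zero and by `u^b` near infinity, with `b < -1 < a`, is
integrable on `(0, ∞)`. -/
theorem integrableOn_Ioi_of_norm_le_rpow {g : ℝ → ℂ} {a b C D : ℝ} (ha : -1 < a) (hb : b < -1)
    (hg : ContinuousOn g (Ioi 0)) (h0 : ∀ u, 0 < u → u ≤ 1 → ‖g u‖ ≤ C * u ^ a)
    (h1 : ∀ u, 1 < u → ‖g u‖ ≤ D * u ^ b) : IntegrableOn g (Ioi 0) := by
  rw [← Ioc_union_Ioi_eq_Ioi (zero_le_one' ℝ)]
  refine IntegrableOn.union ?_ ?_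
  · have hi : IntegrableOn (fun u : ℝ => C * u ^ a) (Ioc 0 1) :=
      (intervalIntegrable_iff_integrableOn_Ioc_of_le zero_le_one).1
        ((intervalIntegral.intervalIntegrable_rpow' ha).const_mul C)
    refine Integrable.mono' hi ((hg.mono Ioc_subset_Ioi_self).aestronglyMeasurable
      measurableSet_Ioc) ?_
    filter_upwards [ae_restrict_mem measurableSet_Ioc] with u hu using h0 u hu.1 hu.2
  · have hi : IntegrableOn (fun u : ℝ => D * u ^ b) (Ioi 1) :=
      (integrableOn_Ioi_rpow_of_lt hb one_pos).const_mul D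
    refine Integrable.mono' hi ((hg.mono (Ioi_subset_Ioi zero_le_one)).aestronglyMeasurable
      measurableSet_Ioi) ?_
    filter_upwards [ae_restrict_mem measurableSet_Ioi] with u hu using h1 u hu

/-! ### Even entire series and the coefficients of J₀ and Y₀ -/

/-- The coefficient sequence of an everywhere convergent power series. -/
def EntireCoeff (c : ℕ → ℝ) : Prop := ∀ r : ℝ, Summable fun k => |c k| * r ^ k

/-- The even power series `∑ c_k (x/2)^(2k)`. -/
noncomputable def evenSeries (c : ℕ → ℝ) (x : ℝ) : ℝ := ∑' k : ℕ, c k * (x / 2) ^ (2 * k)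

/-- The factor k ≤ 2^k is absorbed by doubling the radius. -/
theorem EntireCoeff.natCast_mul {c : ℕ → ℝ} (hc : EntireCoeff c) :
    EntireCoeff fun k => k * c k := by
  intro r
  refine Summable.of_norm_bounded (hc (2 * |r|)) fun k => ?_
  have hk : (k : ℝ) ≤ 2 ^ k := by exact_mod_cast (Nat.lt_two_pow_self (n := k)).le
  rw [norm_mul, norm_pow, Real.norm_eq_abs, Real.norm_eq_abs, abs_abs, abs_mul, Nat.abs_cast,
    mul_pow]
  have : 0 ≤ |c k| * |r| ^ k := by positivity
  nlinarith

theorem EntireCoeff.const_mul {c : ℕ → ℝ} (hc : EntireCoeff c) (a : ℝ) :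
    EntireCoeff fun k => a * c k := by
  intro r
  simpa [abs_mul, mul_assoc] using (hc r).mul_left |a|

theorem EntireCoeff.summable {c : ℕ → ℝ} (hc : EntireCoeff c) (x : ℝ) :
    Summable fun k : ℕ => c k * (x / 2) ^ (2 * k) := by
  refine Summable.of_norm_bounded (hc ((x / 2) ^ 2)) fun k => ?_
  rw [norm_mul, Real.norm_eq_abs, pow_mul, norm_pow, Real.norm_of_nonneg (sq_nonneg (x / 2))]

theorem EntireCoeff.hasDerivAt_evenSeries {c : ℕ → ℝ} (hc : EntireCoeff c) (x : ℝ) :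
    HasDerivAt (evenSeries c) (∑' k : ℕ, c k * (k * (x / 2) ^ (2 * k - 1))) x := by
  -- The margin 2 gives R/2 ≥ 1, so the exponent 2k - 1 can be raised to 2k in the dominating
  -- series, which also covers the truncated exponent at k = 0.
  set R : ℝ := |x| + 2 with hR
  have hR1 : 1 ≤ R / 2 := by
    have := abs_nonneg x
    rw [hR]; linarith
  have hu := hc.natCast_mul ((R / 2) ^ 2)
  refine hasDerivAt_tsum_of_isPreconnected (t := Metric.ball 0 R) (y₀ := 0) hu Metric.isOpen_ball
    (convex_ball 0 R).isPreconnected (g := fun k y => c k * (y / 2) ^ (2 * k))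
    (g' := fun k y => c k * (k * (y / 2) ^ (2 * k - 1))) ?_ ?_ ?_ (hc.summable 0) ?_
  · intro k y _
    have h := (((hasDerivAt_id y).div_const 2).pow (2 * k)).const_mul (c k)
    refine h.congr_deriv ?_
    push_cast
    simp only [id]
    ring
  · intro k y hy
    have hy' : |y / 2| ≤ R / 2 := by
      rw [abs_div, abs_two]
      have := mem_ball_zero_iff.1 hy
      rw [Real.norm_eq_abs] at this
      linarith
    rw [norm_mul, norm_mul, norm_pow, Real.norm_eq_abs, Real.norm_eq_abs, Real.norm_eq_abs,
      abs_mul, ← pow_mul]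
    calc |c k| * (|(k : ℝ)| * |y / 2| ^ (2 * k - 1))
        ≤ |c k| * (|(k : ℝ)| * (R / 2) ^ (2 * k)) := by
          gcongr
          calc |y / 2| ^ (2 * k - 1) ≤ (R / 2) ^ (2 * k - 1) := by gcongr
            _ ≤ (R / 2) ^ (2 * k) := pow_le_pow_right₀ hR1 (by omega)
      _ = _ := by ring
  · exact Metric.mem_ball_self (by linarith)
  · rw [mem_ball_zero_iff, Real.norm_eq_abs, hR]
    linarith

/-- `x d/dx` acts on even series by multiplying the coefficients by `2k`. -/
theorem EntireCoeff.hasDerivAt_evenSeries_div {c : ℕ → ℝ} (hc : EntireCoeff c) {x : ℝ}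
    (hx : 0 < x) :
    HasDerivAt (evenSeries c) (evenSeries (fun k => 2 * (k * c k)) x / x) x := by
  refine (hc.hasDerivAt_evenSeries x).congr_deriv ?_
  rw [evenSeries, ← tsum_div_const]
  refine tsum_congr fun k => ?_
  rcases k with _ | k
  · simp
  · rw [show 2 * (k + 1) - 1 = 2 * k + 1 by omega, show 2 * (k + 1) = 2 * k + 1 + 1 by ring,
      pow_succ _ (2 * k + 1)]
    field_simp

theorem EntireCoeff.evenSeries_eq_zero_add {c : ℕ → ℝ} (hc : EntireCoeff c) (x : ℝ) :
    evenSeries c x = c 0 + (x / 2) ^ 2 * evenSeries (fun k => c (k + 1)) x := by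
  rw [evenSeries, (hc.summable x).tsum_eq_zero_add, evenSeries, ← tsum_mul_left]
  simp only [mul_zero, pow_zero, mul_one]
  congr 1
  refine tsum_congr fun k => ?_
  ring

/-- The coefficients `(-1)^k / (k!)²` of `J₀`. -/
noncomputable def coeffJ (k : ℕ) : ℝ := (-1) ^ k / (k.factorial : ℝ) ^ 2

/-- The coefficients `(-1)^k H_k / (k!)²` occurring in `Y₀`. -/
noncomputable def coeffY (k : ℕ) : ℝ :=
  (-1) ^ k * ((harmonic k : ℚ) : ℝ) / (k.factorial : ℝ) ^ 2

theorem entireCoeff_of_abs_le {c : ℕ → ℝ} (h : ∀ k, |c k| ≤ 1 / k.factorial) : EntireCoeff c := by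
  intro r
  refine Summable.of_norm_bounded (Real.summable_pow_div_factorial |r|) fun k => ?_
  rw [norm_mul, norm_pow, Real.norm_eq_abs, Real.norm_eq_abs, abs_abs, div_eq_inv_mul,
    ← one_div]
  gcongr
  exact h k

theorem one_le_factorial_cast (k : ℕ) : (1 : ℝ) ≤ k.factorial := by
  exact_mod_cast Nat.factorial_pos k

theorem entireCoeff_coeffJ : EntireCoeff coeffJ := by
  refine entireCoeff_of_abs_le fun k => ?_
  have h := one_le_factorial_cast k
  rw [coeffJ, abs_div, abs_pow, abs_neg, abs_one, one_pow, abs_of_nonneg (by positivity)]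
  gcongr
  nlinarith

theorem harmonic_cast_nonneg (k : ℕ) : (0 : ℝ) ≤ ((harmonic k : ℚ) : ℝ) := by
  have : (0 : ℚ) ≤ harmonic k := Finset.sum_nonneg fun i _ => by positivity
  exact_mod_cast this

theorem harmonic_cast_le (k : ℕ) : ((harmonic k : ℚ) : ℝ) ≤ k := by
  have : harmonic k ≤ k := by
    induction k with
    | zero => simp
    | succ n ih =>
      rw [harmonic_succ]
      have : ((↑(n + 1) : ℚ))⁻¹ ≤ 1 := by
        apply inv_le_one_of_one_le₀
        exact_mod_cast Nat.succ_pos n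
      push_cast at *
      linarith
  exact_mod_cast this

theorem entireCoeff_coeffY : EntireCoeff coeffY := by
  refine entireCoeff_of_abs_le fun k => ?_
  have h := one_le_factorial_cast k
  have hk : (k : ℝ) ≤ k.factorial := by exact_mod_cast Nat.self_le_factorial k
  have hh := (harmonic_cast_le k).trans hk
  rw [coeffY, abs_div, abs_mul, abs_pow, abs_neg, abs_one, one_pow, one_mul,
    abs_of_nonneg (harmonic_cast_nonneg k), abs_of_nonneg (by positivity), sq,
    div_le_div_iff₀ (by positivity) (by positivity)]
  nlinarith

/-- This is the Bessel equation read off coefficientwise: (x d/dx)² multiplies the k-th coefficient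
by 4k², and the factor x² shifts the index. -/
theorem coeffJ_succ (k : ℕ) : ((k : ℝ) + 1) ^ 2 * coeffJ (k + 1) = -coeffJ k := by
  have h : ((k.factorial : ℝ)) ≠ 0 := by positivity
  rw [coeffJ, coeffJ, Nat.factorial_succ]
  push_cast
  field_simp
  ring

/-- The extra term comes from H_{k+1} - H_k = 1/(k+1). It is the source that the logarithm in Y₀ has
to cancel. -/
theorem coeffY_succ (k : ℕ) :
    ((k : ℝ) + 1) ^ 2 * coeffY (k + 1) = -coeffY k + (k + 1) * coeffJ (k + 1) := by
  have h : ((k.factorial : ℝ)) ≠ 0 := by positivity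
  rw [coeffY, coeffY, coeffJ, Nat.factorial_succ, harmonic_succ]
  push_cast
  field_simp
  ring

/-! ### The Bessel equation, the Wronskian and uniqueness -/

/-- `y` solves the Bessel equation of order zero on `(0, ∞)` and `p = x y'`, written as a first
order system. -/
def IsBesselPair (y p : ℝ → ℂ) : Prop :=
  ∀ x, 0 < x → HasDerivAt y (p x / x) x ∧ HasDerivAt p (-(x * y x)) x

theorem IsBesselPair.add {y p z q : ℝ → ℂ} (h : IsBesselPair y p) (h' : IsBesselPair z q) :
    IsBesselPair (fun x => y x + z x) (fun x => p x + q x) := fun x hx =>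
  ⟨((h x hx).1.add (h' x hx).1).congr_deriv (by ring),
    ((h x hx).2.add (h' x hx).2).congr_deriv (by ring)⟩

theorem IsBesselPair.const_mul {y p : ℝ → ℂ} (h : IsBesselPair y p) (a : ℂ) :
    IsBesselPair (fun x => a * y x) (fun x => a * p x) := fun x hx =>
  ⟨((h x hx).1.const_mul a).congr_deriv (by ring), ((h x hx).2.const_mul a).congr_deriv (by ring)⟩

/-- The Wronskian of two solutions is constant. -/
theorem IsBesselPair.exists_wronskian_eq {y p z q : ℝ → ℂ} (h : IsBesselPair y p)
    (h' : IsBesselPair z q) : ∃ C : ℂ, ∀ x, 0 < x → y x * q x - p x * z x = C := by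
  have hd : ∀ x ∈ Ioi (0 : ℝ), HasDerivAt (fun x => y x * q x - p x * z x) 0 x := by
    intro x hx
    refine (((h x hx).1.mul (h' x hx).2).sub ((h x hx).2.mul (h' x hx).1)).congr_deriv ?_
    ring
  refine ⟨y 1 * q 1 - p 1 * z 1, fun x hx => ?_⟩
  exact isOpen_Ioi.is_const_of_deriv_eq_zero (convex_Ioi (0 : ℝ)).isPreconnected
    (fun x hx => (hd x hx).differentiableAt.differentiableWithinAt)
    (fun x hx => (hd x hx).deriv) hx (mem_Ioi.2 one_pos)

theorem besselJ0_eq_evenSeries : besselJ0 = evenSeries coeffJ := rfl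

/-- `x J₀'(x)`. -/
noncomputable def thetaJ : ℝ → ℝ := evenSeries fun k => 2 * (k * coeffJ k)

/-- The entire part of `Y₀`. -/
noncomputable def entireY : ℝ → ℝ := evenSeries coeffY

/-- `x d/dx` of the entire part of `Y₀`. -/
noncomputable def thetaEntireY : ℝ → ℝ := evenSeries fun k => 2 * (k * coeffY k)

theorem besselY0_eq (x : ℝ) : besselY0 x =
    2 / Real.pi * ((Real.log (x / 2) + Real.eulerMascheroniConstant) * besselJ0 x - entireY x) := by
  rw [besselY0, entireY, evenSeries, mul_sub, ← mul_assoc]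
  rfl

theorem hasDerivAt_besselJ0 {x : ℝ} (hx : 0 < x) : HasDerivAt besselJ0 (thetaJ x / x) x :=
  entireCoeff_coeffJ.hasDerivAt_evenSeries_div hx

theorem hasDerivAt_entireY {x : ℝ} (hx : 0 < x) : HasDerivAt entireY (thetaEntireY x / x) x :=
  entireCoeff_coeffY.hasDerivAt_evenSeries_div hx

theorem hasDerivAt_thetaJ {x : ℝ} (hx : 0 < x) : HasDerivAt thetaJ (-(x * besselJ0 x)) x := by
  have hc := entireCoeff_coeffJ.natCast_mul.const_mul 2
  refine (hc.hasDerivAt_evenSeries_div hx).congr_deriv ?_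
  rw [(hc.natCast_mul.const_mul 2).evenSeries_eq_zero_add]
  have : (fun k : ℕ => 2 * (((k + 1 : ℕ) : ℝ) * (2 * (((k + 1 : ℕ) : ℝ) * coeffJ (k + 1)))))
      = fun k => -4 * coeffJ k := by
    funext k
    have := coeffJ_succ k
    push_cast
    linear_combination 4 * this
  rw [this, besselJ0_eq_evenSeries, evenSeries, evenSeries]
  simp only [mul_assoc, tsum_mul_left]
  field_simp
  push_cast
  ring

/-- The entire part of Y₀ solves the equation only up to 2θJ/x, where θJ = x J₀'. Differentiating
log(x/2) · J₀ twice by x d/dx produces the same source, so the two cancel in Y₀. -/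
theorem hasDerivAt_thetaEntireY {x : ℝ} (hx : 0 < x) :
    HasDerivAt thetaEntireY (-(x * entireY x) + 2 * thetaJ x / x) x := by
  have hc := entireCoeff_coeffY.natCast_mul.const_mul 2
  have hJ := entireCoeff_coeffJ.natCast_mul.const_mul 2
  refine (hc.hasDerivAt_evenSeries_div hx).congr_deriv ?_
  have hs := (hc.natCast_mul.const_mul 2).summable x
  have h1 : evenSeries (fun k => 2 * ((k : ℝ) * (2 * (k * coeffY k)))) x
      = 2 * thetaJ x - x ^ 2 * entireY x := by
    rw [(hc.natCast_mul.const_mul 2).evenSeries_eq_zero_add, thetaJ,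
      hJ.evenSeries_eq_zero_add]
    have e : evenSeries
        (fun k : ℕ => 2 * (((k + 1 : ℕ) : ℝ) * (2 * (((k + 1 : ℕ) : ℝ) * coeffY (k + 1))))) x
        = -4 * entireY x +
          2 * evenSeries (fun k : ℕ => 2 * (((k + 1 : ℕ) : ℝ) * coeffJ (k + 1))) x := by
      have s1 := (entireCoeff_coeffY.summable x).mul_left (-4)
      -- The underlying bound is (k+1)/((k+1)!)² ≤ 1/k!.
      have hJ' : EntireCoeff fun k : ℕ => 2 * (((k + 1 : ℕ) : ℝ) * coeffJ (k + 1)) := by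
        refine entireCoeff_of_abs_le ?_ |>.const_mul 2
        intro k
        have h1 := one_le_factorial_cast k
        rw [coeffJ, Nat.factorial_succ, abs_mul, Nat.abs_cast, abs_div, abs_pow, abs_neg, abs_one,
          one_pow, abs_of_nonneg (by positivity), mul_one_div, div_le_div_iff₀ (by positivity)
          (by positivity)]
        push_cast
        have : (0:ℝ) ≤ k := by positivity
        nlinarith [mul_nonneg this (sub_nonneg.2 h1), mul_nonneg (mul_nonneg this this)
          (by positivity : (0:ℝ) ≤ (k.factorial : ℝ) ^ 2), mul_nonneg this (sq_nonneg (k.factorial : ℝ)),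
          mul_nonneg (mul_nonneg this (sub_nonneg.2 h1)) (by positivity : (0:ℝ) ≤ (k.factorial : ℝ)),
          mul_nonneg (sub_nonneg.2 h1) (by positivity : (0:ℝ) ≤ (k.factorial : ℝ))]
      have s2 := (hJ'.summable x).mul_left 2
      rw [entireY, evenSeries, evenSeries, evenSeries, ← tsum_mul_left, ← tsum_mul_left,
        ← s1.tsum_add s2]
      refine tsum_congr fun k => ?_
      have := coeffY_succ k
      push_cast
      linear_combination 4 * (x / 2) ^ (2 * k) * this
    rw [e]
    push_cast
    ring
  rw [h1]
  field_simp
  ring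

/-- `x Y₀'(x)`. -/
noncomputable def thetaY (x : ℝ) : ℝ :=
  2 / Real.pi * (besselJ0 x +
    (Real.log (x / 2) + Real.eulerMascheroniConstant) * thetaJ x - thetaEntireY x)

theorem isBesselPair_J : IsBesselPair (fun x => besselJ0 x) (fun x => thetaJ x) := by
  intro x hx
  exact ⟨by simpa using (hasDerivAt_besselJ0 hx).ofReal_comp,
    by simpa using (hasDerivAt_thetaJ hx).ofReal_comp⟩

theorem hasDerivAt_log_half {x : ℝ} (hx : 0 < x) :
    HasDerivAt (fun x => Real.log (x / 2) + Real.eulerMascheroniConstant) (1 / x) x := by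
  have h := (((hasDerivAt_id x).div_const 2).log (by simp [hx.ne'])).add_const
    Real.eulerMascheroniConstant
  refine h.congr_deriv ?_
  simp
  field_simp

theorem isBesselPair_Y : IsBesselPair (fun x => besselY0 x) (fun x => thetaY x) := by
  intro x hx
  have hl := hasDerivAt_log_half hx
  constructor
  · have h : HasDerivAt besselY0 (thetaY x / x) x := by
      rw [show besselY0 = _ from funext besselY0_eq]
      refine (((hl.mul (hasDerivAt_besselJ0 hx)).sub (hasDerivAt_entireY hx)).const_mul _
        ).congr_deriv ?_
      rw [thetaY]
      ring
    simpa using h.ofReal_comp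
  · have h : HasDerivAt thetaY (-(x * besselY0 x)) x := by
      refine ((((hasDerivAt_besselJ0 hx).add (hl.mul (hasDerivAt_thetaJ hx))).sub
        (hasDerivAt_thetaEntireY hx)).const_mul _).congr_deriv ?_
      rw [besselY0_eq]
      ring
    simpa using h.ofReal_comp

theorem evenSeries_zero (c : ℕ → ℝ) : evenSeries c 0 = c 0 := by
  rw [evenSeries, tsum_eq_single 0]
  · simp
  · intro k hk
    simp [hk]

theorem EntireCoeff.tendsto_evenSeries {c : ℕ → ℝ} (hc : EntireCoeff c) :
    Tendsto (evenSeries c) (𝓝[>] 0) (𝓝 (c 0)) := by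
  have := (hc.hasDerivAt_evenSeries 0).continuousAt.tendsto
  rw [evenSeries_zero] at this
  exact this.mono_left nhdsWithin_le_nhds

theorem tendsto_besselJ0 : Tendsto besselJ0 (𝓝[>] 0) (𝓝 1) := by
  simpa [coeffJ, besselJ0_eq_evenSeries] using entireCoeff_coeffJ.tendsto_evenSeries

theorem tendsto_entireY : Tendsto entireY (𝓝[>] 0) (𝓝 0) := by
  simpa [coeffY, entireY] using entireCoeff_coeffY.tendsto_evenSeries

theorem tendsto_thetaJ : Tendsto thetaJ (𝓝[>] 0) (𝓝 0) := by
  simpa [thetaJ] using (entireCoeff_coeffJ.natCast_mul.const_mul 2).tendsto_evenSeries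

theorem tendsto_thetaEntireY : Tendsto thetaEntireY (𝓝[>] 0) (𝓝 0) := by
  simpa [thetaEntireY] using (entireCoeff_coeffY.natCast_mul.const_mul 2).tendsto_evenSeries

/-- The Wronskian of `J₀` and `Y₀`. -/
theorem wronskian_JY {x : ℝ} (hx : 0 < x) :
    (besselJ0 x : ℂ) * thetaY x - thetaJ x * besselY0 x = 2 / Real.pi := by
  obtain ⟨C, hC⟩ := isBesselPair_J.exists_wronskian_eq isBesselPair_Y
  rw [hC x hx]
  -- In the Wronskian the logarithmic terms cancel identically. What remains extends continuously to
  -- 0, where only J₀(0)² = 1 survives.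
  have h1 : Tendsto (fun x => 2 / Real.pi * (besselJ0 x ^ 2 - besselJ0 x * thetaEntireY x
      + thetaJ x * entireY x)) (𝓝[>] 0) (𝓝 (2 / Real.pi * (1 ^ 2 - 1 * 0 + 0 * 0))) :=
    ((((tendsto_besselJ0.pow 2).sub (tendsto_besselJ0.mul tendsto_thetaEntireY)).add
      (tendsto_thetaJ.mul tendsto_entireY)).const_mul _)
  have h2 := (Complex.continuous_ofReal.tendsto _).comp h1
  have h3 : Tendsto (fun _ : ℝ => C) (𝓝[>] 0)
      (𝓝 ((2 / Real.pi * (1 ^ 2 - 1 * 0 + 0 * 0) : ℝ) : ℂ)) := by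
    refine h2.congr' ?_
    filter_upwards [self_mem_nhdsWithin] with y hy
    rw [← hC y hy, Function.comp_apply, besselY0_eq, thetaY]
    push_cast
    ring
  have := tendsto_nhds_unique tendsto_const_nhds h3
  rw [this]
  push_cast
  ring

/-- Every solution of the Bessel equation on `(0, ∞)` is a combination of `J₀` and `Y₀`. -/
theorem IsBesselPair.exists_eq_combination {y p : ℝ → ℂ} (h : IsBesselPair y p) :
    ∃ a b : ℂ, ∀ x, 0 < x → y x = a * besselJ0 x + b * besselY0 x := by
  obtain ⟨C, hC⟩ := h.exists_wronskian_eq isBesselPair_J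
  obtain ⟨D, hD⟩ := h.exists_wronskian_eq isBesselPair_Y
  have hpi : (Real.pi : ℂ) ≠ 0 := by exact_mod_cast Real.pi_ne_zero
  -- Cramer's rule for the system in (y, p), with determinant 2/π.
  refine ⟨Real.pi / 2 * D, -(Real.pi / 2 * C), fun x hx => ?_⟩
  rw [← hC x hx, ← hD x hx]
  have hw := wronskian_JY hx
  have h2 : (Real.pi : ℂ) / 2 * (2 / Real.pi) = 1 := by field_simp
  linear_combination (-(Real.pi : ℂ) / 2 * y x) * hw - y x * h2

/-! ### The Laplace integral solves the Bessel equation -/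

theorem norm_exp_I_sub_mul (u x : ℝ) : ‖exp ((I - u) * x)‖ = Real.exp (-(u * x)) := by
  rw [Complex.norm_exp]
  simp

theorem norm_I_sub_le {u : ℝ} (hu : 0 < u) : ‖I - (u : ℂ)‖ ≤ 1 + u := by
  refine (norm_sub_le _ _).trans ?_
  simp [abs_of_pos hu]

theorem tendsto_one_add_pow_mul_exp_neg {b : ℝ} (hb : 0 < b) (n : ℕ) :
    Tendsto (fun u : ℝ => (1 + u) ^ n * Real.exp (-(u * b))) atTop (𝓝 0) := by
  have h := (tendsto_rpow_mul_exp_neg_mul_atTop_nhds_zero n b hb).const_mul (2 ^ n)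
  rw [mul_zero] at h
  refine squeeze_zero' ?_ ?_ h
  · filter_upwards [eventually_ge_atTop 0] with u hu
    positivity
  · filter_upwards [eventually_ge_atTop 1] with u hu
    rw [Real.rpow_natCast, ← mul_assoc, ← mul_pow, neg_mul, mul_comm b u]
    gcongr
    linarith

/-- The Laplace-type integrals `∫ e^{(i - u) x} g(u) du` converge absolutely for all `x > 0`. -/
def LaplaceIntegrable (g : ℝ → ℂ) : Prop :=
  ∀ x : ℝ, 0 < x → IntegrableOn (fun u : ℝ => exp ((I - u) * x) * g u) (Ioi 0)

/-- Half of the exponential pays for the linear factor. This lets convergence at x/2 control the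
differentiated integral at x. -/
theorem one_add_mul_exp_neg_le {u x : ℝ} (hu : 0 < u) (hx : 0 < x) :
    (1 + u) * Real.exp (-(u * x)) ≤ (1 + 2 / x) * Real.exp (-(u * (x / 2))) := by
  have h1 : 1 + u ≤ (1 + 2 / x) * Real.exp (u * (x / 2)) := by
    have h := Real.add_one_le_exp (u * (x / 2))
    have h2 : (1 + 2 / x) * (u * (x / 2) + 1) = 1 + u + u * (x / 2) + 2 / x := by
      field_simp
      ring
    have h3 : (1 + 2 / x) * (u * (x / 2) + 1) ≤ (1 + 2 / x) * Real.exp (u * (x / 2)) := by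
      gcongr
    have : 0 < u * (x / 2) + 2 / x := by positivity
    linarith
  calc (1 + u) * Real.exp (-(u * x))
      ≤ (1 + 2 / x) * Real.exp (u * (x / 2)) * Real.exp (-(u * x)) := by gcongr
    _ = _ := by
      rw [mul_assoc, ← Real.exp_add]
      ring_nf

theorem LaplaceIntegrable.mul {g : ℝ → ℂ} (hg : LaplaceIntegrable g)
    (hc : ContinuousOn g (Ioi 0)) : LaplaceIntegrable fun u => (I - u) * g u := by
  intro x hx
  refine Integrable.mono' (((hg (x / 2) (by positivity)).norm).const_mul (1 + 2 / x))
    (ContinuousOn.aestronglyMeasurable (by fun_prop) measurableSet_Ioi) ?_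
  filter_upwards [ae_restrict_mem measurableSet_Ioi] with u hu
  rw [norm_mul, norm_mul, norm_mul, norm_exp_I_sub_mul, norm_exp_I_sub_mul]
  have h1 := norm_I_sub_le hu
  have h2 := one_add_mul_exp_neg_le hu hx
  calc Real.exp (-(u * x)) * (‖I - (u : ℂ)‖ * ‖g u‖)
      ≤ Real.exp (-(u * x)) * ((1 + u) * ‖g u‖) := by gcongr
    _ = (1 + u) * Real.exp (-(u * x)) * ‖g u‖ := by ring
    _ ≤ (1 + 2 / x) * Real.exp (-(u * (x / 2))) * ‖g u‖ := by gcongr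
    _ = _ := by ring

theorem LaplaceIntegrable.hasDerivAt {g : ℝ → ℂ} (hg : LaplaceIntegrable g)
    (hc : ContinuousOn g (Ioi 0)) {x : ℝ} (hx : 0 < x) :
    HasDerivAt (fun y : ℝ => ∫ u in Ioi (0 : ℝ), exp ((I - u) * y) * g u)
      (∫ u in Ioi (0 : ℝ), exp ((I - u) * x) * ((I - u) * g u)) x := by
  refine (hasDerivAt_integral_of_dominated_loc_of_deriv_le (𝕜 := ℝ) (s := Ioi (x / 2))
    -- The norm of e^{(i-u)y} decreases in y, so on (x/2, ∞) the differentiated integrand is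
    -- dominated by its value at x/2.
    (μ := volume.restrict (Ioi 0)) (F := fun (y : ℝ) (u : ℝ) => exp ((I - u) * y) * g u)
    (bound := fun u : ℝ => ‖exp ((I - u) * (x / 2 : ℝ)) * ((I - u) * g u)‖)
    (F' := fun (y : ℝ) (u : ℝ) => exp ((I - u) * y) * ((I - u) * g u))
    (Ioi_mem_nhds (half_lt_self hx)) ?_ (hg x hx) ?_ ?_ ?_ ?_).2
  · exact .of_forall fun y => ContinuousOn.aestronglyMeasurable (by fun_prop) measurableSet_Ioi
  · exact ContinuousOn.aestronglyMeasurable (by fun_prop) measurableSet_Ioi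
  · filter_upwards [ae_restrict_mem measurableSet_Ioi] with u hu y hy
    rw [norm_mul, norm_mul _ ((I - (u : ℂ)) * g u), norm_exp_I_sub_mul, norm_exp_I_sub_mul]
    have : u * (x / 2) ≤ u * y := mul_le_mul_of_nonneg_left (le_of_lt hy) (le_of_lt hu)
    gcongr
  · exact ((hg.mul hc) (x / 2) (by positivity)).norm
  · refine .of_forall fun u y _ => ?_
    have h1 : HasDerivAt (fun y : ℝ => (I - u) * (y : ℂ)) (I - u) y := by
      simpa using (Complex.ofRealCLM.hasDerivAt (x := y)).const_mul (I - (u : ℂ))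
    exact (h1.cexp.mul_const (g u)).congr_deriv (by ring)

theorem laplaceIntegrable_hankelKernel : LaplaceIntegrable hankelKernel := by
  intro x hx
  have hc := continuousOn_hankelKernel
  refine integrableOn_Ioi_of_norm_le_rpow (a := -(1 / 2)) (b := -2) (C := 1) (D := 1 / x)
    (by norm_num) (by norm_num) (by fun_prop) ?_ ?_
  · intro u hu _
    rw [norm_mul, norm_exp_I_sub_mul]
    refine mul_le_mul ?_ (norm_hankelKernel_le_rpow hu) (norm_nonneg _) zero_le_one
    rw [Real.exp_le_one_iff]
    have := mul_pos hu hx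
    linarith
  · intro u hu
    have hu0 : 0 < u := by linarith
    rw [norm_mul, norm_exp_I_sub_mul]
    have h1 : Real.exp (-(u * x)) ≤ (u * x)⁻¹ := by
      rw [Real.exp_neg]
      have := Real.add_one_le_exp (u * x)
      exact inv_anti₀ (by positivity) (by linarith)
    calc _ ≤ (u * x)⁻¹ * u⁻¹ :=
          mul_le_mul h1 (norm_hankelKernel_le_inv hu0) (norm_nonneg _) (by positivity)
      _ = _ := by
        rw [Real.rpow_neg hu0.le]
        norm_num
        field_simp

/-- The Laplace integral `∫₀^∞ e^{(i - u) x} u^{-1/2} (2i - u)^{-1/2} du`. -/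
noncomputable def hankelLaplace (x : ℝ) : ℂ :=
  ∫ u in Ioi (0 : ℝ), exp ((I - u) * x) * hankelKernel u

theorem hasDerivAt_sqrt_mul_branchRoot {u : ℝ} (hu : 0 < u) :
    HasDerivAt (fun u : ℝ => ((√u : ℝ) : ℂ) * branchRoot u) ((I - u) * hankelKernel u) u := by
  refine ((hasDerivAt_ofReal_sqrt hu).mul (hasDerivAt_branchRoot u)).congr_deriv ?_
  have h1 := ofReal_sqrt_ne_zero hu
  have h2 := branchRoot_ne_zero u
  have h3 := ofReal_sqrt_sq hu.le
  have h4 := branchRoot_sq u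
  rw [hankelKernel]
  field_simp
  rw [h3, h4]
  ring

theorem sqrt_mul_branchRoot_eq {u : ℝ} (hu : 0 < u) :
    ((√u : ℝ) : ℂ) * branchRoot u = u * (2 * I - u) * hankelKernel u := by
  have h1 := ofReal_sqrt_ne_zero hu
  have h2 := branchRoot_ne_zero u
  rw [hankelKernel, ← branchRoot_sq, ← ofReal_sqrt_sq hu.le]
  field_simp

theorem tendsto_sqrt_mul_branchRoot_zero :
    Tendsto (fun u : ℝ => ((√u : ℝ) : ℂ) * branchRoot u) (𝓝[>] 0) (𝓝 0) := by
  have h := continuous_branchRoot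
  have : Continuous fun u : ℝ => ((√u : ℝ) : ℂ) * branchRoot u := by fun_prop
  simpa using (this.tendsto 0).mono_left nhdsWithin_le_nhds

theorem norm_sqrt_mul_branchRoot_le {u : ℝ} (hu : 0 ≤ u) :
    ‖((√u : ℝ) : ℂ) * branchRoot u‖ ≤ 2 + u := by
  rw [norm_mul, Complex.norm_real, Real.norm_of_nonneg (Real.sqrt_nonneg u)]
  calc √u * ‖branchRoot u‖ ≤ ‖branchRoot u‖ * ‖branchRoot u‖ := by
        gcongr; exact sqrt_le_norm_branchRoot u
    _ ≤ 2 + u := by rw [← sq]; exact norm_branchRoot_sq_le hu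

theorem isBesselPair_hankelLaplace : IsBesselPair hankelLaplace fun x =>
    x * ∫ u in Ioi (0 : ℝ), exp ((I - u) * x) * ((I - u) * hankelKernel u) := by
  intro x hx
  have hc := continuousOn_hankelKernel
  have hL := laplaceIntegrable_hankelKernel
  have hc1 : ContinuousOn (fun u : ℝ => (I - u) * hankelKernel u) (Ioi 0) := by fun_prop
  have hL1 := hL.mul hc
  have hL2 := hL1.mul hc1
  have hx' : (x : ℂ) ≠ 0 := by exact_mod_cast hx.ne'
  constructor
  · exact (hL.hasDerivAt hc hx).congr_deriv (mul_div_cancel_left₀ _ hx').symm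
  · have hd := (Complex.ofRealCLM.hasDerivAt (x := x)).mul (hL1.hasDerivAt hc1 hx)
    refine hd.congr_deriv ?_
    -- The expression (x y')' + x y is the integral of the exact derivative of e^{(i-u)x} √u
    -- √(2i-u), because -u(2i-u) = (i-u)² + 1. The primitive vanishes at both ends.
    have key : ∫ u in Ioi (0 : ℝ), ((x : ℂ) * (exp ((I - u) * x) * ((I - u) * ((I - u) *
        hankelKernel u))) + x * (exp ((I - u) * x) * hankelKernel u)
        + exp ((I - u) * x) * ((I - u) * hankelKernel u)) = 0 - 0 := by
      refine integral_Ioi_eq_sub_of_tendsto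
        (f := fun u : ℝ => exp ((I - u) * x) * (((√u : ℝ) : ℂ) * branchRoot u)) ?_ ?_ ?_ ?_
      · intro u hu
        have h1 : HasDerivAt (fun u : ℝ => (I - u) * (x : ℂ)) (-x) u := by
          simpa using ((Complex.ofRealCLM.hasDerivAt (x := u)).const_sub I).mul_const (x : ℂ)
        refine (h1.cexp.mul (hasDerivAt_sqrt_mul_branchRoot hu)).congr_deriv ?_
        rw [sqrt_mul_branchRoot_eq hu]
        linear_combination (-exp ((I - u) * x) * x * hankelKernel u) * I_sq
      · exact (((hL2 x hx).const_mul _).add ((hL x hx).const_mul _)).add (hL1 x hx)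
      · have h1 : Tendsto (fun u : ℝ => exp ((I - u) * x)) (𝓝[>] 0) (𝓝 (exp ((I - (0 : ℝ)) * x))) :=
          ((by fun_prop : Continuous fun u : ℝ => exp ((I - u) * x)).tendsto 0).mono_left
            nhdsWithin_le_nhds
        simpa using h1.mul tendsto_sqrt_mul_branchRoot_zero
      · have h2 := (tendsto_one_add_pow_mul_exp_neg hx 1).const_mul 2
        rw [mul_zero] at h2
        refine squeeze_zero_norm' ?_ h2
        filter_upwards [eventually_ge_atTop 0] with u hu
        rw [norm_mul, norm_exp_I_sub_mul]
        have := norm_sqrt_mul_branchRoot_le hu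
        have h3 := Real.exp_pos (-(u * x))
        nlinarith
    have i2 := (hL2 x hx).const_mul (x : ℂ)
    have i0 := (hL x hx).const_mul (x : ℂ)
    have i1 := hL1 x hx
    beta_reduce at i1 i2
    rw [integral_add (i2.fun_add i0) i1, integral_add i2 i0, integral_const_mul,
      integral_const_mul] at key
    rw [hankelLaplace]
    simp only [ofRealCLM_apply, ofReal_one, one_mul]
    linear_combination key

/-! ### Uniformization and logarithmic primitives -/

/-- The uniformizing variable `i √u / √(2i - u)`, running from `0` to `1` inside the first
quadrant. -/
noncomputable def unifVar (u : ℝ) : ℂ := I / rootRatio u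

theorem unifVar_eq (u : ℝ) : unifVar u = I * (√u : ℝ) / branchRoot u := by
  rw [unifVar, rootRatio]
  field_simp

theorem unifVar_re_pos {u : ℝ} (hu : 0 < u) : 0 < (unifVar u).re := by
  have h := rootRatio_im_pos hu
  have hn := Complex.normSq_pos.2 (rootRatio_ne_zero hu)
  rw [unifVar, Complex.div_re]
  simp only [I_re, I_im, zero_mul, zero_div, one_mul, zero_add]
  positivity

theorem unifVar_im_pos {u : ℝ} (hu : 0 < u) : 0 < (unifVar u).im := by
  have h := rootRatio_re_pos hu
  have hn := Complex.normSq_pos.2 (rootRatio_ne_zero hu)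
  rw [unifVar, Complex.div_im]
  simp only [I_re, I_im, zero_mul, zero_div, one_mul, sub_zero]
  positivity

theorem norm_unifVar (u : ℝ) : ‖unifVar u‖ = √u / ‖branchRoot u‖ := by
  rw [unifVar_eq, norm_div, norm_mul, norm_I, one_mul, Complex.norm_real,
    Real.norm_of_nonneg (Real.sqrt_nonneg u)]

theorem norm_unifVar_le_one (u : ℝ) : ‖unifVar u‖ ≤ 1 := by
  rw [norm_unifVar]
  exact div_le_one_of_le₀ (sqrt_le_norm_branchRoot u) (norm_nonneg _)

theorem tendsto_unifVar_zero : Tendsto unifVar (𝓝[>] 0) (𝓝 0) := by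
  have h := continuous_branchRoot
  have : Continuous unifVar := by
    rw [show unifVar = _ from funext unifVar_eq]
    exact Continuous.div (by fun_prop) h branchRoot_ne_zero
  have h2 := (this.tendsto 0).mono_left (nhdsWithin_le_nhds (s := Ioi 0))
  rwa [unifVar_eq, Real.sqrt_zero, ofReal_zero, mul_zero, zero_div] at h2

theorem tendsto_unifVar_atTop : Tendsto unifVar atTop (𝓝 1) := by
  have := (tendsto_const_nhds (x := I)).div tendsto_rootRatio I_ne_zero
  rwa [div_self I_ne_zero] at this

theorem unifVar_sq_mul {u : ℝ} (hu : 0 ≤ u) : unifVar u ^ 2 * branchRoot u ^ 2 = -u := by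
  have h := branchRoot_ne_zero u
  rw [unifVar_eq, div_pow, mul_pow, I_sq, ofReal_sqrt_sq hu]
  field_simp

theorem hasDerivAt_unifVar {u : ℝ} (hu : 0 < u) :
    HasDerivAt unifVar (-hankelKernel u / branchRoot u ^ 2) u := by
  rw [show unifVar = _ from funext unifVar_eq]
  have h0 := branchRoot_ne_zero u
  have h1 := ofReal_sqrt_ne_zero hu
  refine (((hasDerivAt_ofReal_sqrt hu).const_mul I).div (hasDerivAt_branchRoot u) h0
    ).congr_deriv ?_
  have h2 := branchRoot_sq u
  have h3 := ofReal_sqrt_sq hu.le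
  rw [hankelKernel]
  field_simp
  rw [h2, h3]
  linear_combination 2 * I_sq

/-- The Möbius map z ↦ (1+z)/(1-z) has real coefficients and positive determinant, so it preserves
the upper half-plane. -/
theorem im_one_add_div_one_sub_pos {z : ℂ} (hz : 0 < z.im) : 0 < ((1 + z) / (1 - z)).im := by
  have hne : 1 - z ≠ 0 := by
    intro h
    have := congrArg Complex.im h
    simp at this
    linarith
  have hn := Complex.normSq_pos.2 hne
  rw [Complex.div_im, ← sub_div]
  apply div_pos _ hn
  simp
  nlinarith

/-- Arguments add: one in [0, π/2] and one in (0, π/2) sum to one in (0, π). -/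
theorem mul_im_pos {κ z : ℂ} (h1 : 0 ≤ κ.re) (h2 : 0 ≤ κ.im) (h0 : κ ≠ 0) (hr : 0 < z.re)
    (hi : 0 < z.im) : 0 < (κ * z).im := by
  rw [mul_im]
  rcases h1.eq_or_lt with h | h
  · rcases h2.eq_or_lt with h' | h'
    · exact absurd (Complex.ext h.symm h'.symm) h0
    · have := mul_pos h' hr
      have := mul_nonneg h1 hi.le
      linarith
  · have := mul_pos h hi
    have := mul_nonneg h2 hr.le
    linarith

/-- `Log ((1 + κ v) / (1 - κ v))` with `v` the uniformizing variable. -/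
noncomputable def logPrimitive (κ : ℂ) (u : ℝ) : ℂ :=
  Complex.log ((1 + κ * unifVar u) / (1 - κ * unifVar u))

theorem one_sub_ne_zero_of_im_pos {z : ℂ} (hz : 0 < z.im) : 1 - z ≠ 0 ∧ 1 + z ≠ 0 := by
  constructor <;>
  · intro h
    have := congrArg Complex.im h
    simp at this
    linarith

/-- Rationalization: the denominator linear in u becomes a difference of squares in v. With κ² =
(β-1)/(β+1) its left side is a multiple of 1 + β + iu. -/
theorem denom_eq_mul {κ : ℂ} {u : ℝ} (hu : 0 < u) : 2 * I - (1 - κ ^ 2) * u =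
    branchRoot u ^ 2 * ((1 - κ * unifVar u) * (1 + κ * unifVar u)) := by
  linear_combination (-1 : ℂ) * branchRoot_sq u + κ ^ 2 * unifVar_sq_mul hu.le

theorem hasDerivAt_logPrimitive {κ : ℂ} (h1 : 0 ≤ κ.re) (h2 : 0 ≤ κ.im) (h0 : κ ≠ 0) {u : ℝ}
    (hu : 0 < u) : HasDerivAt (logPrimitive κ)
      (-2 * κ * hankelKernel u / (2 * I - (1 - κ ^ 2) * u)) u := by
  have him := mul_im_pos h1 h2 h0 (unifVar_re_pos hu) (unifVar_im_pos hu)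
  obtain ⟨hn1, hn2⟩ := one_sub_ne_zero_of_im_pos him
  have hs : (1 + κ * unifVar u) / (1 - κ * unifVar u) ∈ slitPlane :=
    Or.inr (im_one_add_div_one_sub_pos him).ne'
  have hd := (hasDerivAt_unifVar hu).const_mul κ
  have h := ((hd.const_add 1).div (hd.const_sub 1) hn1).clog_real hs
  refine h.congr_deriv ?_
  have hb := branchRoot_ne_zero u
  rw [denom_eq_mul hu]
  simp only [Pi.div_apply]
  field_simp
  ring

theorem tendsto_logPrimitive_zero (κ : ℂ) : Tendsto (logPrimitive κ) (𝓝[>] 0) (𝓝 0) := by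
  have hv := tendsto_unifVar_zero.const_mul κ
  have h := ((tendsto_const_nhds (x := (1 : ℂ))).add hv).div
    ((tendsto_const_nhds (x := (1 : ℂ))).sub hv) (by simp)
  have h2 := h.clog (by simp)
  rw [mul_zero, add_zero, sub_zero, div_one, Complex.log_one] at h2
  exact h2

/-- The principal logarithm is continuous up to its cut from above. The cut is reached when β < -1:
then κ > 1 is real, (1+κ)/(1-κ) is negative, and the approach is through the upper half-plane. -/
theorem tendsto_log_of_im_nonneg {f : ℝ → ℂ} {l : Filter ℝ} {w : ℂ} (hw : w ≠ 0)
    (hf : Tendsto f l (𝓝 w)) (him : ∀ᶠ u in l, 0 ≤ (f u).im) :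
    Tendsto (fun u => Complex.log (f u)) l (𝓝 (Complex.log w)) := by
  by_cases hs : w ∈ slitPlane
  · exact hf.clog hs
  · have hre : w.re < 0 ∧ w.im = 0 := by
      rw [mem_slitPlane_iff, not_or, not_lt, not_not] at hs
      refine ⟨lt_of_le_of_ne hs.1 fun h => hw (Complex.ext h hs.2), hs.2⟩
    exact (continuousWithinAt_log_of_re_neg_of_im_zero hre.1 hre.2).tendsto.comp
      (tendsto_nhdsWithin_iff.2 ⟨hf, him⟩)

theorem tendsto_logPrimitive_atTop {κ : ℂ} (h1 : 0 ≤ κ.re) (h2 : 0 ≤ κ.im) (h0 : κ ≠ 0)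
    (hκ : κ ≠ 1) :
    Tendsto (logPrimitive κ) atTop (𝓝 (Complex.log ((1 + κ) / (1 - κ)))) := by
  have hp : 1 + κ ≠ 0 := by
    intro h
    have := congrArg Complex.re h
    simp at this
    linarith
  have hm : 1 - κ ≠ 0 := sub_ne_zero.2 hκ.symm
  have hv := tendsto_unifVar_atTop.const_mul κ
  rw [mul_one] at hv
  refine tendsto_log_of_im_nonneg (div_ne_zero hp hm) ((hv.const_add 1).div (hv.const_sub 1) hm) ?_
  filter_upwards [eventually_gt_atTop 0] with u hu
  exact (im_one_add_div_one_sub_pos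
    (mul_im_pos h1 h2 h0 (unifVar_re_pos hu) (unifVar_im_pos hu))).le

theorem hasDerivAt_logPrimitive_one {u : ℝ} (hu : 0 < u) :
    HasDerivAt (logPrimitive 1) (I * hankelKernel u) u := by
  refine (hasDerivAt_logPrimitive (κ := 1) (by simp) (by simp) one_ne_zero hu).congr_deriv ?_
  have := I_ne_zero
  field_simp
  simp only [sub_self, zero_mul, sub_zero]
  linear_combination (-2 * hankelKernel u) * I_sq

/-- From 1 - v² = 2i/(2i-u) one gets (1+v)/(1-v) = (1+v)²(2i-u)/(2i). Pulling the positive factor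
1+u out of the logarithm isolates its growth; the rest stays bounded and away from zero. -/
theorem logPrimitive_one_sub_log {u : ℝ} (hu : 0 < u) :
    logPrimitive 1 u - Real.log (1 + u) =
      Complex.log ((1 + unifVar u) ^ 2 * ((2 * I - u) / (1 + u)) / (2 * I)) := by
  have him := unifVar_im_pos hu
  obtain ⟨hn1, hn2⟩ := one_sub_ne_zero_of_im_pos him
  have hu1 : (0 : ℝ) < 1 + u := by linarith
  have hu1c : (1 + (u : ℂ)) ≠ 0 := by exact_mod_cast hu1.ne'
  have hd := denom_eq_mul (κ := 1) hu
  have hb := branchRoot_ne_zero u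
  have e : (1 + unifVar u) / (1 - unifVar u) = ((1 + u : ℝ) : ℂ) *
      ((1 + unifVar u) ^ 2 * ((2 * I - u) / (1 + u)) / (2 * I)) := by
    rw [← branchRoot_sq]
    rw [one_pow, sub_self, zero_mul, sub_zero, one_mul] at hd
    rw [hd]
    push_cast
    field_simp
  have hne : (1 + unifVar u) ^ 2 * ((2 * I - u) / (1 + u)) / (2 * I) ≠ 0 := by
    rw [← branchRoot_sq]
    exact div_ne_zero (mul_ne_zero (pow_ne_zero _ hn2) (div_ne_zero (pow_ne_zero _ hb) hu1c))
      (mul_ne_zero two_ne_zero I_ne_zero)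
  rw [logPrimitive, one_mul, e, Complex.log_ofReal_mul hu1 hne]
  ring

theorem norm_logPrimitive_one_sub_log_le {u : ℝ} (hu : 0 < u) :
    ‖logPrimitive 1 u - Real.log (1 + u)‖ ≤ 4 + Real.pi := by
  rw [logPrimitive_one_sub_log hu]
  set w := (1 + unifVar u) ^ 2 * ((2 * I - u) / (1 + u)) / (2 * I) with hw
  have hu1 : (0 : ℝ) < 1 + u := by linarith
  have hN : ‖w‖ = ‖1 + unifVar u‖ ^ 2 * (‖branchRoot u‖ ^ 2 / (1 + u)) / 2 := by
    rw [hw, norm_div, norm_mul, norm_pow, norm_div, ← branchRoot_sq, norm_pow, norm_mul, norm_I]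
    rw [show (1 + (u : ℂ)) = ((1 + u : ℝ) : ℂ) by push_cast; rfl, Complex.norm_real,
      Real.norm_of_nonneg hu1.le]
    simp
  have ha1 : 1 ≤ ‖1 + unifVar u‖ := by
    refine le_trans ?_ ((le_abs_self _).trans (Complex.abs_re_le_norm _))
    have := unifVar_re_pos hu
    simp only [add_re, one_re]
    linarith
  have ha2 : ‖1 + unifVar u‖ ≤ 2 := by
    refine (norm_add_le _ _).trans ?_
    have := norm_unifVar_le_one u
    rw [norm_one]
    linarith
  have hb1 : 1 / 2 ≤ ‖branchRoot u‖ ^ 2 / (1 + u) := by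
    rw [le_div_iff₀ hu1]
    have := two_le_norm_branchRoot_sq u
    have := le_norm_branchRoot_sq u
    linarith
  have hb2 : ‖branchRoot u‖ ^ 2 / (1 + u) ≤ 2 := by
    rw [div_le_iff₀ hu1]
    have := norm_branchRoot_sq_le hu.le
    linarith
  have hlow : 1 / 4 ≤ ‖w‖ := by
    rw [hN]
    have : 1 ≤ ‖1 + unifVar u‖ ^ 2 := one_le_pow₀ ha1
    nlinarith
  have hup : ‖w‖ ≤ 4 := by
    rw [hN]
    have : ‖1 + unifVar u‖ ^ 2 ≤ 4 := by nlinarith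
    have h0 : 0 ≤ ‖1 + unifVar u‖ ^ 2 := by positivity
    nlinarith
  have hpos : 0 < ‖w‖ := by linarith
  have hlog : |Real.log ‖w‖| ≤ 4 := by
    rw [abs_le]
    constructor
    · have := Real.one_sub_inv_le_log_of_pos hpos
      have h4 : ‖w‖⁻¹ ≤ 4 := by
        rw [inv_le_comm₀ hpos (by norm_num)]
        linarith
      linarith
    · have := Real.log_le_sub_one_of_pos hpos
      linarith
  refine (Complex.norm_le_abs_re_add_abs_im _).trans ?_
  rw [Complex.log_re, Complex.log_im]
  exact add_le_add hlog (Complex.abs_arg_le_pi _)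

/-- As v → 1 and (2i-u)/(1+u) → -1, the remaining argument tends to 2i, which is off the cut. Its
logarithm supplies the constants log 2 and iπ/2 of the expansion at the origin. -/
theorem tendsto_logPrimitive_one_sub_log :
    Tendsto (fun u : ℝ => logPrimitive 1 u - Real.log (1 + u)) atTop
      (𝓝 (Real.log 2 + Real.pi / 2 * I)) := by
  have hr : Tendsto (fun u : ℝ => (2 * I - (u : ℂ)) / (1 + u)) atTop (𝓝 (-1)) := by
    rw [tendsto_iff_norm_sub_tendsto_zero]
    have h0 : Tendsto (fun u : ℝ => 3 / (1 + u)) atTop (𝓝 0) :=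
      tendsto_const_nhds.div_atTop (tendsto_atTop_add_const_left _ 1 tendsto_id)
    refine squeeze_zero' (.of_forall fun _ => norm_nonneg _) ?_ h0
    filter_upwards [eventually_gt_atTop 0] with u hu
    have hu1 : (0 : ℝ) < 1 + u := by linarith
    have hu1c : (1 + (u : ℂ)) ≠ 0 := by exact_mod_cast hu1.ne'
    have e : (2 * I - (u : ℂ)) / (1 + u) - -1 = (2 * I + 1) / ((1 + u : ℝ) : ℂ) := by
      push_cast
      field_simp
      ring
    rw [e, norm_div, Complex.norm_real, Real.norm_of_nonneg hu1.le]
    gcongr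
    refine (norm_add_le _ _).trans ?_
    simp
    norm_num
  have h := ((((tendsto_unifVar_atTop.const_add 1).pow 2).mul hr).div_const (2 * I))
  have e : (1 + 1 : ℂ) ^ 2 * -1 / (2 * I) = 2 * I := by
    have := I_ne_zero
    field_simp
    rw [I_sq]
    norm_num
  rw [e] at h
  have hl := h.clog (by right; simp)
  have e2 : Complex.log (2 * I) = Real.log 2 + Real.pi / 2 * I := by
    rw [show (2 * I : ℂ) = ((2 : ℝ) : ℂ) * I by push_cast; rfl,
      Complex.log_ofReal_mul two_pos I_ne_zero, Complex.log_I]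
  rw [e2] at hl
  refine hl.congr' ?_
  filter_upwards [eventually_gt_atTop 0] with u hu
  exact (logPrimitive_one_sub_log hu).symm

/-! ### Behaviour of the Laplace integral at the origin -/

theorem integral_exp_neg_mul_log :
    ∫ t in Ioi (0 : ℝ), ((Real.exp (-t) * Real.log t : ℝ) : ℂ) = -Real.eulerMascheroniConstant := by
  -- The integral is Γ'(1), obtained by differentiating Euler's integral under the integral sign;
  -- its value is -γ.
  have h1 := Complex.hasDerivAt_GammaIntegral (s := 1) (by simp)
  have h2 : HasDerivAt GammaIntegral (-Real.eulerMascheroniConstant) 1 := by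
    refine Complex.hasDerivAt_Gamma_one.congr_of_eventuallyEq ?_
    have : {z : ℂ | 0 < z.re} ∈ 𝓝 (1 : ℂ) :=
      (isOpen_lt continuous_const Complex.continuous_re).mem_nhds (by simp)
    filter_upwards [this] with z hz using (Complex.Gamma_eq_integral hz).symm
  rw [← h1.unique h2]
  refine setIntegral_congr_fun measurableSet_Ioi fun t _ => ?_
  simp only [sub_self, cpow_zero, one_mul]
  push_cast
  ring

theorem integrableOn_exp_neg_mul_log :
    IntegrableOn (fun t : ℝ => ((Real.exp (-t) * Real.log t : ℝ) : ℂ)) (Ioi 0) := by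
  -- A non-integrable function has Bochner integral 0, whereas this integral is -γ ≠ 0.
  by_contra h
  have h1 := integral_exp_neg_mul_log
  rw [integral_undef h] at h1
  have h2 : Real.eulerMascheroniConstant = 0 := by
    have : (Real.eulerMascheroniConstant : ℂ) = 0 := by
      rw [← neg_eq_zero, ← h1]
    exact_mod_cast this
  have := Real.one_half_lt_eulerMascheroniConstant
  linarith

theorem integrableOn_one_add_mul_exp_neg {x : ℝ} (hx : 0 < x) :
    IntegrableOn (fun u : ℝ => (1 + u) * Real.exp (-(u * x))) (Ioi 0) := by
  have h : IntegrableOn (fun u : ℝ => (1 + 2 / x) * Real.exp (-(x / 2) * u)) (Ioi 0) :=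
    (integrableOn_exp_mul_Ioi (a := -(x / 2)) (by linarith) 0).const_mul _
  refine Integrable.mono' h (by fun_prop) ?_
  filter_upwards [ae_restrict_mem measurableSet_Ioi] with u hu
  have hu' : (0 : ℝ) < u := hu
  rw [Real.norm_of_nonneg (by positivity)]
  refine (one_add_mul_exp_neg_le hu' hx).trans (le_of_eq ?_)
  ring_nf

theorem continuousOn_logPrimitive_one : ContinuousOn (logPrimitive 1) (Ioi 0) := fun _ hu =>
  (hasDerivAt_logPrimitive_one hu).continuousAt.continuousWithinAt

theorem norm_logPrimitive_one_le {u : ℝ} (hu : 0 < u) :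
    ‖logPrimitive 1 u‖ ≤ (4 + Real.pi) * (1 + u) := by
  have h1 := norm_logPrimitive_one_sub_log_le hu
  have h2 : ‖((Real.log (1 + u) : ℝ) : ℂ)‖ ≤ u := by
    rw [Complex.norm_real, Real.norm_of_nonneg (Real.log_nonneg (by linarith))]
    have := Real.log_le_sub_one_of_pos (show 0 < 1 + u by linarith)
    linarith
  have h3 := norm_add_le (logPrimitive 1 u - Real.log (1 + u)) (Real.log (1 + u) : ℂ)
  rw [sub_add_cancel] at h3
  have := Real.pi_pos
  nlinarith

/-- Integration by parts against a primitive of i times the kernel, followed by u = t/x. The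
x-dependence moves into a slowly growing factor, which makes the limit x → 0⁺ accessible. -/
theorem I_mul_hankelLaplace {x : ℝ} (hx : 0 < x) :
    I * hankelLaplace x = exp (I * x) *
      ∫ t in Ioi (0 : ℝ), exp (-(t : ℂ)) * logPrimitive 1 (t / x) := by
  have hpi := Real.pi_pos
  have hxc : (x : ℂ) ≠ 0 := by exact_mod_cast hx.ne'
  have hnorm : ∀ u : ℝ, ‖exp (-((u : ℂ) * x))‖ = Real.exp (-(u * x)) := by
    intro u
    rw [Complex.norm_exp]
    simp
  have hint2 : IntegrableOn (fun u : ℝ => exp (-((u : ℂ) * x)) * logPrimitive 1 u) (Ioi 0) := by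
    refine Integrable.mono' ((integrableOn_one_add_mul_exp_neg hx).const_mul (4 + Real.pi)) ?_ ?_
    · have := continuousOn_logPrimitive_one
      exact ContinuousOn.aestronglyMeasurable (by fun_prop) measurableSet_Ioi
    · filter_upwards [ae_restrict_mem measurableSet_Ioi] with u hu
      rw [norm_mul, hnorm]
      have := norm_logPrimitive_one_le hu
      calc _ ≤ Real.exp (-(u * x)) * ((4 + Real.pi) * (1 + u)) := by gcongr
        _ = _ := by ring
  have hsplit : ∀ u : ℝ, exp ((I - u) * x) = exp (I * x) * exp (-((u : ℂ) * x)) := by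
    intro u
    rw [← Complex.exp_add]
    ring_nf
  have hint1 : IntegrableOn (fun u : ℝ => exp (-((u : ℂ) * x)) * hankelKernel u) (Ioi 0) := by
    have h := (laplaceIntegrable_hankelKernel x hx).const_mul (exp (-(I * x)))
    refine h.congr (.of_forall fun u => ?_)
    simp only
    rw [← mul_assoc, ← Complex.exp_add]
    ring_nf
  have key : ∫ u in Ioi (0 : ℝ), (I * (exp (-((u : ℂ) * x)) * hankelKernel u)
      - x * (exp (-((u : ℂ) * x)) * logPrimitive 1 u)) = 0 - 0 := by
    refine integral_Ioi_eq_sub_of_tendsto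
      (f := fun u : ℝ => exp (-((u : ℂ) * x)) * logPrimitive 1 u) ?_
      ((hint1.const_mul I).sub (hint2.const_mul _)) ?_ ?_
    · intro u hu
      have h1 : HasDerivAt (fun u : ℝ => -((u : ℂ) * (x : ℂ))) (-x) u := by
        exact ((Complex.ofRealCLM.hasDerivAt (x := u)).mul_const (x : ℂ)).fun_neg.congr_deriv
          (by simp)
      refine (h1.cexp.mul (hasDerivAt_logPrimitive_one hu)).congr_deriv ?_
      ring
    · have h1 : Tendsto (fun u : ℝ => exp (-((u : ℂ) * x))) (𝓝[>] 0)
          (𝓝 (exp (-(((0 : ℝ) : ℂ) * x)))) :=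
        ((by fun_prop : Continuous fun u : ℝ => exp (-((u : ℂ) * x))).tendsto 0).mono_left
          nhdsWithin_le_nhds
      simpa using h1.mul (tendsto_logPrimitive_zero 1)
    · have h2 := (tendsto_one_add_pow_mul_exp_neg hx 1).const_mul (4 + Real.pi)
      rw [mul_zero] at h2
      refine squeeze_zero_norm' ?_ h2
      filter_upwards [eventually_gt_atTop 0] with u hu
      rw [norm_mul, hnorm, pow_one]
      have := norm_logPrimitive_one_le hu
      calc _ ≤ Real.exp (-(u * x)) * ((4 + Real.pi) * (1 + u)) := by gcongr
        _ = _ := by ring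
  rw [integral_sub (hint1.const_mul I) (hint2.const_mul _), integral_const_mul,
    integral_const_mul] at key
  have hchange : ∫ t in Ioi (0 : ℝ), exp (-(t : ℂ)) * logPrimitive 1 (t / x) =
      x * ∫ u in Ioi (0 : ℝ), exp (-((u : ℂ) * x)) * logPrimitive 1 u := by
    have h := integral_comp_mul_right_Ioi
      (fun t : ℝ => exp (-(t : ℂ)) * logPrimitive 1 (t / x)) 0 hx
    simp only [zero_mul] at h
    have h2 : ∀ u : ℝ, u * x / x = u := fun u => by field_simp
    simp only [h2, ofReal_mul] at h
    rw [h, Complex.real_smul]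
    push_cast
    field_simp
  rw [hchange, hankelLaplace]
  simp only [hsplit, mul_assoc]
  rw [integral_const_mul]
  linear_combination exp (I * x) * key

/-- This is an x-independent integrable majorant (against e^{-t}) for the dominated convergence as x
→ 0⁺. -/
theorem abs_log_add_le {t x : ℝ} (ht : 0 < t) (hx : 0 < x) (hx1 : x ≤ 1) :
    |Real.log (t + x)| ≤ |Real.log t| + t := by
  rcases le_total 1 (t + x) with h | h
  · rw [abs_of_nonneg (Real.log_nonneg h)]
    have h1 := Real.log_le_sub_one_of_pos (show 0 < t + x by linarith)
    have := abs_nonneg (Real.log t)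
    linarith
  · rw [abs_of_nonpos (Real.log_nonpos (by linarith) h)]
    have h1 := Real.log_le_log ht (show t ≤ t + x by linarith)
    have := neg_abs_le (Real.log t)
    linarith

theorem integral_exp_neg_complex : ∫ t in Ioi (0 : ℝ), exp (-(t : ℂ)) = 1 := by
  have h := integral_exp_neg_Ioi 0
  have h2 : ∫ t in Ioi (0 : ℝ), exp (-(t : ℂ)) = ((∫ t in Ioi (0 : ℝ), Real.exp (-t) : ℝ) : ℂ) := by
    rw [← integral_complex_ofReal]
    simp
  rw [h2, h]
  simp

theorem integrableOn_exp_neg_complex : IntegrableOn (fun t : ℝ => exp (-(t : ℂ))) (Ioi 0) := by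
  have h := (exp_neg_integrableOn_Ioi 0 one_pos).ofReal (𝕜 := ℂ)
  simpa [IntegrableOn] using h

theorem tendsto_integral_logPrimitive_add_log :
    Tendsto (fun x : ℝ => (∫ t in Ioi (0 : ℝ), exp (-(t : ℂ)) * logPrimitive 1 (t / x))
      + Real.log x) (𝓝[>] 0)
      (𝓝 (Real.log 2 + Real.pi / 2 * I - Real.eulerMascheroniConstant)) := by
  have hpi := Real.pi_pos
  have hlim : Tendsto (fun x : ℝ => ∫ t in Ioi (0 : ℝ), exp (-(t : ℂ)) *
      (logPrimitive 1 (t / x) + Real.log x)) (𝓝[>] 0)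
      (𝓝 (∫ t in Ioi (0 : ℝ), exp (-(t : ℂ)) *
        (Real.log 2 + Real.pi / 2 * I + Real.log t))) := by
    have hbint : IntegrableOn (fun t : ℝ => (4 + Real.pi) * ((1 + t) * Real.exp (-(t * 1)))
        + ‖((Real.exp (-t) * Real.log t : ℝ) : ℂ)‖) (Ioi 0) :=
      ((integrableOn_one_add_mul_exp_neg one_pos).const_mul _).add
        integrableOn_exp_neg_mul_log.norm
    refine tendsto_integral_filter_of_dominated_convergence _ ?_ ?_ hbint ?_
    · filter_upwards [self_mem_nhdsWithin] with x hx
      have h1 : ContinuousOn (fun t : ℝ => logPrimitive 1 (t / x)) (Ioi 0) :=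
        continuousOn_logPrimitive_one.comp (by fun_prop) fun t ht => mem_Ioi.2 (div_pos ht hx)
      exact ContinuousOn.aestronglyMeasurable (by fun_prop) measurableSet_Ioi
    · have h1 : ∀ᶠ x : ℝ in 𝓝[>] 0, x ≤ 1 :=
        nhdsWithin_le_nhds (Iic_mem_nhds one_pos)
      filter_upwards [self_mem_nhdsWithin, h1] with x hx hx1
      filter_upwards [ae_restrict_mem measurableSet_Ioi] with t ht
      have hx' : (0 : ℝ) < x := hx
      have ht' : (0 : ℝ) < t := ht
      -- Since log(1 + t/x) + log x = log(t + x), the divergence in x cancels, leaving a bounded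
      -- term and a logarithm with limit log t.
      have e : logPrimitive 1 (t / x) + Real.log x =
          (logPrimitive 1 (t / x) - Real.log (1 + t / x)) + Real.log (t + x) := by
        have : Real.log (t + x) = Real.log (1 + t / x) + Real.log x := by
          rw [← Real.log_mul (by positivity) hx'.ne']
          congr 1
          field_simp
          ring
        rw [this]
        push_cast
        ring
      have hn : ‖exp (-(t : ℂ))‖ = Real.exp (-t) := by
        rw [Complex.norm_exp]; simp
      rw [norm_mul, e, hn, Complex.norm_real, Real.norm_eq_abs, abs_mul,
        abs_of_pos (Real.exp_pos _)]
      have h2 := norm_logPrimitive_one_sub_log_le (div_pos ht' hx')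
      have h3 := abs_log_add_le ht' hx' hx1
      have h4 := norm_add_le (logPrimitive 1 (t / x) - Real.log (1 + t / x))
        (Real.log (t + x) : ℂ)
      rw [Complex.norm_real, Real.norm_eq_abs] at h4
      have h5 : ‖logPrimitive 1 (t / x) - Real.log (1 + t / x) + (Real.log (t + x) : ℂ)‖
          ≤ (4 + Real.pi) * (1 + t) + |Real.log t| := by nlinarith
      have h6 := mul_le_mul_of_nonneg_left h5 (Real.exp_pos (-t)).le
      rw [mul_one]
      linarith
    · filter_upwards [ae_restrict_mem measurableSet_Ioi] with t ht
      refine Tendsto.const_mul _ ?_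
      have ht' : (0 : ℝ) < t := ht
      have hdiv : Tendsto (fun x : ℝ => t / x) (𝓝[>] 0) atTop := by
        simpa [div_eq_mul_inv] using tendsto_inv_nhdsGT_zero.const_mul_atTop ht'
      have h1 := tendsto_logPrimitive_one_sub_log.comp hdiv
      have h2 : Tendsto (fun x : ℝ => ((Real.log (t + x) : ℝ) : ℂ)) (𝓝[>] 0)
          (𝓝 ((Real.log t : ℝ) : ℂ)) := by
        have h3 : ContinuousAt (fun x : ℝ => Real.log (t + x)) 0 :=
          ContinuousAt.log (by fun_prop) (by simpa using ht'.ne')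
        have h4 := h3.tendsto.mono_left (nhdsWithin_le_nhds (s := Ioi 0))
        rw [add_zero] at h4
        exact (Complex.continuous_ofReal.tendsto _).comp h4
      refine (h1.add h2).congr' ?_
      filter_upwards [self_mem_nhdsWithin] with x hx
      have hx' : (0 : ℝ) < x := hx
      have : Real.log (t + x) = Real.log (1 + t / x) + Real.log x := by
        rw [← Real.log_mul (by positivity) hx'.ne']
        congr 1
        field_simp
        ring
      rw [this, Function.comp_apply]
      push_cast
      ring
  have hval : ∫ t in Ioi (0 : ℝ), exp (-(t : ℂ)) * (Real.log 2 + Real.pi / 2 * I + Real.log t) =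
      Real.log 2 + Real.pi / 2 * I - Real.eulerMascheroniConstant := by
    have e : ∀ t : ℝ, exp (-(t : ℂ)) * (Real.log 2 + Real.pi / 2 * I + Real.log t) =
        exp (-(t : ℂ)) * (Real.log 2 + Real.pi / 2 * I)
          + ((Real.exp (-t) * Real.log t : ℝ) : ℂ) := by
      intro t
      push_cast
      ring
    simp only [e]
    rw [integral_add (integrableOn_exp_neg_complex.mul_const _) integrableOn_exp_neg_mul_log,
      integral_mul_const, integral_exp_neg_complex, integral_exp_neg_mul_log]
    ring
  rw [hval] at hlim
  refine hlim.congr' ?_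
  filter_upwards [self_mem_nhdsWithin] with x hx
  have hx' : (0 : ℝ) < x := hx
  have hi : IntegrableOn (fun t : ℝ => exp (-(t : ℂ)) * logPrimitive 1 (t / x)) (Ioi 0) := by
    refine Integrable.mono' ((integrableOn_one_add_mul_exp_neg one_pos).const_mul
      ((4 + Real.pi) * (1 + 1 / x))) ?_ ?_
    · have h1 : ContinuousOn (fun t : ℝ => logPrimitive 1 (t / x)) (Ioi 0) :=
        continuousOn_logPrimitive_one.comp (by fun_prop) fun t ht => mem_Ioi.2 (div_pos ht hx)
      exact ContinuousOn.aestronglyMeasurable (by fun_prop) measurableSet_Ioi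
    · filter_upwards [ae_restrict_mem measurableSet_Ioi] with t ht
      have ht' : (0 : ℝ) < t := ht
      have hn : ‖exp (-(t : ℂ))‖ = Real.exp (-t) := by
        rw [Complex.norm_exp]; simp
      rw [norm_mul, hn, mul_one]
      have h1 := norm_logPrimitive_one_le (div_pos ht' hx')
      have h2 : 1 + t / x ≤ (1 + 1 / x) * (1 + t) := by
        have : (1 + 1 / x) * (1 + t) = 1 + t / x + (t + 1 / x) := by ring
        have : 0 < t + 1 / x := by positivity
        linarith
      calc _ ≤ Real.exp (-t) * ((4 + Real.pi) * ((1 + 1 / x) * (1 + t))) := by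
            gcongr
            exact h1.trans (by gcongr)
        _ = _ := by ring
  simp only [mul_add]
  rw [integral_add hi (integrableOn_exp_neg_complex.mul_const _), integral_mul_const,
    integral_exp_neg_complex, one_mul]

theorem tendsto_log_mul_self : Tendsto (fun x : ℝ => x * Real.log x) (𝓝[>] 0) (𝓝 0) := by
  have := tendsto_log_mul_rpow_nhdsGT_zero one_pos
  simpa [mul_comm] using this

/-- If `f` is differentiable at `0`, then `(f x - f 0) log x → 0` as `x → 0⁺`. -/
theorem tendsto_sub_mul_log {f : ℝ → ℂ} {f' : ℂ} (hf : HasDerivAt f f' 0) :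
    Tendsto (fun x : ℝ => (f x - f 0) * Real.log x) (𝓝[>] 0) (𝓝 0) := by
  have h1 := hf.tendsto_slope_zero_right
  have h2 := h1.mul ((Complex.continuous_ofReal.tendsto _).comp tendsto_log_mul_self)
  rw [ofReal_zero, mul_zero] at h2
  refine h2.congr' ?_
  filter_upwards [self_mem_nhdsWithin] with x hx
  have hxc : (x : ℂ) ≠ 0 := by exact_mod_cast (ne_of_gt hx)
  simp only [zero_add, Function.comp_apply, Complex.real_smul]
  push_cast
  field_simp

theorem tendsto_hankelLaplace_sub_log :
    Tendsto (fun x : ℝ => hankelLaplace x - I * Real.log x) (𝓝[>] 0)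
      (𝓝 (Real.pi / 2 + I * (Real.eulerMascheroniConstant - Real.log 2))) := by
  have hd : HasDerivAt (fun x : ℝ => exp (I * x)) (exp (I * (0 : ℝ)) * I) 0 := by
    have h1 : HasDerivAt (fun x : ℝ => I * (x : ℂ)) I 0 := by
      simpa using (Complex.ofRealCLM.hasDerivAt (x := 0)).const_mul I
    exact h1.cexp
  have h1 := tendsto_sub_mul_log hd
  have h2 := hd.continuousAt.tendsto.mono_left (nhdsWithin_le_nhds (s := Ioi 0))
  have h3 := ((h2.mul tendsto_integral_logPrimitive_add_log).sub h1).const_mul (-I)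
  simp only [ofReal_zero, mul_zero, Complex.exp_zero, one_mul, sub_zero] at h3
  have e : -I * (Real.log 2 + Real.pi / 2 * I - Real.eulerMascheroniConstant) =
      Real.pi / 2 + I * (Real.eulerMascheroniConstant - Real.log 2) := by
    linear_combination (-(Real.pi : ℂ) / 2) * I_sq
  rw [e] at h3
  refine h3.congr' ?_
  filter_upwards [self_mem_nhdsWithin] with x hx
  have h4 := I_mul_hankelLaplace hx
  linear_combination I * h4 - hankelLaplace x * I_sq

/-- The series give (π/2)H₀⁽¹⁾ - i log x = J₀ (π/2 + i(γ - log 2)) + i((J₀ - 1) log x - E), with E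
the entire part of Y₀. The last bracket tends to 0, so the constant is that of the Laplace integral.
-/
theorem tendsto_hankelH10_sub_log :
    Tendsto (fun x : ℝ => Real.pi / 2 * hankelH10 x - I * Real.log x) (𝓝[>] 0)
      (𝓝 (Real.pi / 2 + I * (Real.eulerMascheroniConstant - Real.log 2))) := by
  have hpi : (Real.pi : ℂ) ≠ 0 := by exact_mod_cast Real.pi_ne_zero
  have hd : HasDerivAt (fun x : ℝ => (besselJ0 x : ℂ)) _ 0 :=
    (entireCoeff_coeffJ.hasDerivAt_evenSeries 0).ofReal_comp
  have h1 := tendsto_sub_mul_log hd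
  have hJ0 : besselJ0 0 = 1 := by
    rw [besselJ0_eq_evenSeries, evenSeries_zero]
    simp [coeffJ]
  rw [hJ0] at h1
  have hJ := (Complex.continuous_ofReal.tendsto _).comp tendsto_besselJ0
  have hY := (Complex.continuous_ofReal.tendsto _).comp tendsto_entireY
  have h2 := (hJ.mul_const
    ((Real.pi : ℂ) / 2 + I * (Real.eulerMascheroniConstant - Real.log 2))).add
      ((h1.sub hY).const_mul I)
  simp only [ofReal_zero, mul_zero, sub_zero, add_zero, ofReal_one, one_mul] at h2
  refine h2.congr' ?_
  filter_upwards [self_mem_nhdsWithin] with x hx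
  have hx' : x ≠ 0 := ne_of_gt hx
  simp only [Function.comp_apply]
  rw [hankelH10, besselY0_eq, Real.log_div hx' two_ne_zero]
  push_cast
  field_simp
  ring

/-! ### Identification of H₀⁽¹⁾ with the Laplace integral -/

theorem isBesselPair_hankelH10 : IsBesselPair hankelH10 fun x => thetaJ x + I * thetaY x :=
  isBesselPair_J.add (isBesselPair_Y.const_mul I)

theorem tendsto_div_log {f : ℝ → ℂ} {A : ℂ} (hf : Tendsto f (𝓝[>] 0) (𝓝 A)) :
    Tendsto (fun x => f x / Real.log x) (𝓝[>] 0) (𝓝 0) := by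
  have h1 : Tendsto (fun x : ℝ => ((Real.log x)⁻¹ : ℝ)) (𝓝[>] 0) (𝓝 0) :=
    tendsto_inv_atBot_zero.comp Real.tendsto_log_nhdsGT_zero
  have h2 := hf.mul ((Complex.continuous_ofReal.tendsto _).comp h1)
  rw [ofReal_zero, mul_zero] at h2
  refine h2.congr fun x => ?_
  simp [div_eq_mul_inv]

/-- A solution of the Bessel equation vanishing at `0⁺` is zero. -/
theorem IsBesselPair.eq_zero {y p : ℝ → ℂ} (h : IsBesselPair y p)
    (h0 : Tendsto y (𝓝[>] 0) (𝓝 0)) {x : ℝ} (hx : 0 < x) : y x = 0 := by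
  obtain ⟨a, b, hab⟩ := h.exists_eq_combination
  have hpi : (Real.pi : ℂ) ≠ 0 := by exact_mod_cast Real.pi_ne_zero
  have hJ := (Complex.continuous_ofReal.tendsto _).comp tendsto_besselJ0
  have hH : Tendsto (fun x : ℝ => hankelH10 x / Real.log x) (𝓝[>] 0) (𝓝 (2 / Real.pi * I)) := by
    have h1 := ((tendsto_div_log tendsto_hankelH10_sub_log).add_const I).const_mul
      (2 / (Real.pi : ℂ))
    rw [zero_add] at h1
    refine h1.congr' ?_
    have hlt : ∀ᶠ x : ℝ in 𝓝[>] 0, x < 1 := nhdsWithin_le_nhds (Iio_mem_nhds one_pos)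
    filter_upwards [self_mem_nhdsWithin, hlt] with x hx hx1
    have hl : ((Real.log x : ℝ) : ℂ) ≠ 0 := by exact_mod_cast (Real.log_neg hx hx1).ne
    field_simp
    ring
  -- For x > 0 the numerator equals b H₀⁽¹⁾ and is bounded near 0. Dividing by log x gives limit 0
  -- on one side and b · 2i/π on the other, hence b = 0.
  have hc : Tendsto (fun x : ℝ => (I * y x - I * a * besselJ0 x + b * besselJ0 x) / Real.log x)
      (𝓝[>] 0) (𝓝 0) :=
    tendsto_div_log (((h0.const_mul I).sub (hJ.const_mul (I * a))).add (hJ.const_mul b))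
  have hb : b = 0 := by
    have h1 : Tendsto (fun x : ℝ => b * (hankelH10 x / Real.log x)) (𝓝[>] 0) (𝓝 0) := by
      refine hc.congr' ?_
      filter_upwards [self_mem_nhdsWithin] with x hx
      rw [hab x hx, hankelH10]
      ring
    have h2 := tendsto_nhds_unique h1 (hH.const_mul b)
    have h3 : 2 / (Real.pi : ℂ) * I ≠ 0 := mul_ne_zero (div_ne_zero two_ne_zero hpi) I_ne_zero
    exact (mul_eq_zero.1 h2.symm).resolve_right h3
  have ha : a = 0 := by
    have h1 : Tendsto y (𝓝[>] 0) (𝓝 (a * ((1 : ℝ) : ℂ))) := by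
      refine (hJ.const_mul a).congr' ?_
      filter_upwards [self_mem_nhdsWithin] with x hx
      rw [hab x hx, hb]
      simp
    have h2 := tendsto_nhds_unique h0 h1
    simpa using h2.symm
  rw [hab x hx, ha, hb]
  simp

/-- The Laplace representation of `H₀⁽¹⁾`. -/
theorem hankelH10_eq {x : ℝ} (hx : 0 < x) : hankelH10 x = 2 / Real.pi * hankelLaplace x := by
  have hpi : (Real.pi : ℂ) ≠ 0 := by exact_mod_cast Real.pi_ne_zero
  have hp := (isBesselPair_hankelH10.const_mul (Real.pi / 2)).add
    (isBesselPair_hankelLaplace.const_mul (-1))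
  have h0 : Tendsto (fun x : ℝ => (Real.pi : ℂ) / 2 * hankelH10 x + -1 * hankelLaplace x)
      (𝓝[>] 0) (𝓝 0) := by
    have := tendsto_hankelH10_sub_log.sub tendsto_hankelLaplace_sub_log
    rw [sub_self] at this
    refine this.congr fun x => ?_
    ring
  have h := hp.eq_zero h0 hx
  field_simp
  linear_combination 2 * h

/-! ### Fubini: moments as integrals over the Laplace variable -/

/-- The moments `∫₀¹ xⁿ e^{a x} dx` of an exponential. -/
noncomputable def expMoment (n : ℕ) (a : ℂ) : ℂ := ∫ x in (0 : ℝ)..1, (x : ℂ) ^ n * exp (a * x)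

theorem hasDerivAt_exp_mul_ofReal (a : ℂ) (x : ℝ) :
    HasDerivAt (fun x : ℝ => exp (a * x)) (a * exp (a * x)) x := by
  have h1 : HasDerivAt (fun x : ℝ => a * (x : ℂ)) a x := by
    simpa using (Complex.ofRealCLM.hasDerivAt (x := x)).const_mul a
  exact h1.cexp.congr_deriv (mul_comm _ _)

theorem mul_expMoment_zero (a : ℂ) : a * expMoment 0 a = exp a - 1 := by
  have h := intervalIntegral.integral_eq_sub_of_hasDerivAt (a := 0) (b := 1)
    (fun x _ => hasDerivAt_exp_mul_ofReal a x) (Continuous.intervalIntegrable (by fun_prop) _ _)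
  rw [intervalIntegral.integral_const_mul] at h
  simpa [expMoment] using h

theorem mul_expMoment_succ (n : ℕ) (a : ℂ) :
    a * expMoment (n + 1) a = exp a - (n + 1) * expMoment n a := by
  have hd : ∀ x : ℝ, HasDerivAt (fun x : ℝ => (x : ℂ) ^ (n + 1) * exp (a * x))
      ((n + 1) * ((x : ℂ) ^ n * exp (a * x)) + a * ((x : ℂ) ^ (n + 1) * exp (a * x))) x := by
    intro x
    have h1 : HasDerivAt (fun x : ℝ => (x : ℂ) ^ (n + 1)) ((n + 1) * (x : ℂ) ^ n) x := by
      simpa using (Complex.ofRealCLM.hasDerivAt (x := x)).fun_pow (n + 1)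
    exact (h1.mul (hasDerivAt_exp_mul_ofReal a x)).congr_deriv (by ring)
  have h := intervalIntegral.integral_eq_sub_of_hasDerivAt (a := 0) (b := 1)
    (fun x _ => hd x) (Continuous.intervalIntegrable (by fun_prop) _ _)
  rw [intervalIntegral.integral_add (Continuous.intervalIntegrable (by fun_prop) _ _)
    (Continuous.intervalIntegrable (by fun_prop) _ _), intervalIntegral.integral_const_mul,
    intervalIntegral.integral_const_mul] at h
  simp only [ofReal_one, one_pow, mul_one, one_mul, ofReal_zero, ne_eq, Nat.add_eq_zero_iff,
    one_ne_zero, and_false, not_false_eq_true, zero_pow, zero_mul, sub_zero] at h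
  rw [expMoment, expMoment]
  linear_combination h

/-- The linear function `1 + β + i u`. -/
def linDenom (β u : ℝ) : ℂ := 1 + β + I * u

theorem linDenom_re (β u : ℝ) : (linDenom β u).re = 1 + β := by simp [linDenom]

theorem linDenom_im (β u : ℝ) : (linDenom β u).im = u := by simp [linDenom]

theorem measurable_hankelKernel : Measurable hankelKernel := by
  have h := continuous_branchRoot
  exact measurable_const.div (Continuous.measurable (by fun_prop))

/-- For Fubini, e^{-ωux} is traded for (ωux)^{-1/4}, which splits into powers of x and u. The kernel
is of size u^{-1/2} at 0 and only 1/u at infinity, so any exponent strictly between 0 and 1/2 would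
serve. -/
theorem exp_neg_le_rpow {y : ℝ} (hy : 0 < y) : Real.exp (-y) ≤ y ^ (-(1 / 4) : ℝ) := by
  rw [Real.exp_neg, Real.rpow_neg hy.le]
  refine inv_anti₀ (by positivity) ?_
  have h := Real.add_one_le_exp y
  rcases le_total y 1 with h1 | h1
  · have := Real.rpow_le_one hy.le h1 (show (0 : ℝ) ≤ 1 / 4 by norm_num)
    linarith
  · have := Real.rpow_le_rpow_of_exponent_le h1 (show (1 / 4 : ℝ) ≤ 1 by norm_num)
    rw [Real.rpow_one] at this
    linarith

theorem norm_exp_linDenom (ω β u x : ℝ) :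
    ‖exp (I * ω * linDenom β u * x)‖ = Real.exp (-(ω * u * x)) := by
  rw [Complex.norm_exp]
  congr 1
  simp [linDenom]

theorem integrable_moment_kernel {ω : ℝ} (hω : 0 < ω) (β : ℝ) (n : ℕ) :
    Integrable (Function.uncurry fun (x u : ℝ) =>
        hankelKernel u * ((x : ℂ) ^ n * exp (I * ω * linDenom β u * x)))
      ((volume.restrict (Ioc (0 : ℝ) 1)).prod (volume.restrict (Ioi (0 : ℝ)))) := by
  have hf : IntegrableOn (fun x : ℝ => x ^ (-(1 / 4) : ℝ)) (Ioc 0 1) :=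
    (intervalIntegrable_iff_integrableOn_Ioc_of_le zero_le_one).1
      (intervalIntegral.intervalIntegrable_rpow' (by norm_num))
  have hg : IntegrableOn (fun u : ℝ => ((u ^ (-(1 / 4) : ℝ) : ℝ) : ℂ) * hankelKernel u)
      (Ioi 0) := by
    have hc := continuousOn_hankelKernel
    refine integrableOn_Ioi_of_norm_le_rpow (a := -(3 / 4)) (b := -(5 / 4)) (C := 1) (D := 1)
      (by norm_num) (by norm_num) ?_ ?_ ?_
    · refine ContinuousOn.mul ?_ hc
      refine Complex.continuous_ofReal.comp_continuousOn ?_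
      exact continuousOn_id.rpow_const fun u hu => Or.inl (ne_of_gt hu)
    · intro u hu _
      rw [norm_mul, Complex.norm_real, Real.norm_of_nonneg (by positivity), one_mul]
      calc _ ≤ u ^ (-(1 / 4) : ℝ) * u ^ (-(1 / 2) : ℝ) := by
            gcongr; exact norm_hankelKernel_le_rpow hu
        _ = _ := by rw [← Real.rpow_add hu]; norm_num
    · intro u hu
      have hu0 : 0 < u := by linarith
      rw [norm_mul, Complex.norm_real, Real.norm_of_nonneg (by positivity), one_mul]
      calc _ ≤ u ^ (-(1 / 4) : ℝ) * u⁻¹ := by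
            gcongr; exact norm_hankelKernel_le_inv hu0
        _ = _ := by rw [← Real.rpow_neg_one, ← Real.rpow_add hu0]; norm_num
  have hb := (hf.mul_prod hg.norm).const_mul (ω ^ (-(1 / 4) : ℝ))
  refine Integrable.mono' hb ?_ ?_
  · have := measurable_hankelKernel
    refine Measurable.aestronglyMeasurable ?_
    unfold Function.uncurry linDenom
    refine (this.comp measurable_snd).mul (Continuous.measurable (by fun_prop))
  · rw [Measure.prod_restrict]
    filter_upwards [ae_restrict_mem (measurableSet_Ioc.prod measurableSet_Ioi)] with p hp
    obtain ⟨⟨hx0, hx1⟩, hu⟩ := hp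
    obtain ⟨x, u⟩ := p
    simp only at hx0 hx1 hu
    have hu' : (0 : ℝ) < u := hu
    simp only [Function.uncurry]
    rw [norm_mul, norm_mul, norm_exp_linDenom, norm_pow, Complex.norm_real,
      Real.norm_of_nonneg hx0.le, norm_mul, Complex.norm_real, Real.norm_of_nonneg (by positivity)]
    have h1 : x ^ n ≤ 1 := pow_le_one₀ hx0.le hx1
    have h2 := exp_neg_le_rpow (show 0 < ω * u * x by positivity)
    rw [Real.mul_rpow (by positivity) hx0.le, Real.mul_rpow hω.le hu'.le] at h2
    calc ‖hankelKernel u‖ * (x ^ n * Real.exp (-(ω * u * x)))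
        ≤ ‖hankelKernel u‖ * (1 * (ω ^ (-(1 / 4) : ℝ) * u ^ (-(1 / 4) : ℝ) *
            x ^ (-(1 / 4) : ℝ))) := by gcongr
      _ = _ := by ring

theorem momentIntegrand_eq {ω : ℝ} (hω : 0 < ω) (β : ℝ) (n : ℕ) {x : ℝ} (hx : 0 < x) :
    momentIntegrand ω β (fun x => (x : ℂ) ^ n) x = 2 / Real.pi * ∫ u in Ioi (0 : ℝ),
      hankelKernel u * ((x : ℂ) ^ n * exp (I * ω * linDenom β u * x)) := by
  rw [momentIntegrand, hankelH10_eq (mul_pos hω hx), hankelLaplace]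
  have e : ∀ u : ℝ, hankelKernel u * ((x : ℂ) ^ n * exp (I * ω * linDenom β u * x)) =
      (x : ℂ) ^ n * exp (I * ω * β * x) * (exp ((I - u) * (ω * x : ℝ)) * hankelKernel u) := by
    intro u
    have : exp (I * ω * linDenom β u * x) =
        exp (I * ω * β * x) * exp ((I - u) * (ω * x : ℝ)) := by
      rw [← Complex.exp_add, linDenom]
      congr 1
      push_cast
      linear_combination (ω * u * x : ℂ) * I_sq
    rw [this]
    ring
  simp only [e]
  rw [integral_const_mul]
  ring

theorem intervalIntegrable_momentIntegrand {ω : ℝ} (hω : 0 < ω) (β : ℝ) (n : ℕ) :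
    IntervalIntegrable (momentIntegrand ω β (fun x => (x : ℂ) ^ n)) volume 0 1 := by
  rw [intervalIntegrable_iff_integrableOn_Ioc_of_le zero_le_one]
  refine ((integrable_moment_kernel hω β n).integral_prod_left.const_mul
    (2 / (Real.pi : ℂ))).congr ?_
  filter_upwards [ae_restrict_mem measurableSet_Ioc] with x hx
  exact (momentIntegrand_eq hω β n hx.1).symm

theorem integral_kernel_eq (ω β : ℝ) (n : ℕ) (u : ℝ) :
    ∫ x in Ioc (0 : ℝ) 1, hankelKernel u * ((x : ℂ) ^ n * exp (I * ω * linDenom β u * x)) =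
      hankelKernel u * expMoment n (I * ω * linDenom β u) := by
  rw [integral_const_mul, expMoment, intervalIntegral.integral_of_le zero_le_one]

theorem integrableOn_kernel_mul_expMoment {ω : ℝ} (hω : 0 < ω) (β : ℝ) (n : ℕ) :
    IntegrableOn (fun u => hankelKernel u * expMoment n (I * ω * linDenom β u)) (Ioi 0) := by
  have h := (integrable_moment_kernel hω β n).integral_prod_right
  refine h.congr (.of_forall fun u => ?_)
  exact integral_kernel_eq ω β n u

/-- Inserting the Laplace representation and exchanging integrals leaves an elementary exponential
moment in x. This is the common starting point of the cases β ≠ -1 and β = -1. -/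
theorem rho_eq {ω : ℝ} (hω : 0 < ω) (β : ℝ) (n : ℕ) :
    rho ω β n = 2 / Real.pi * ∫ u in Ioi (0 : ℝ),
      hankelKernel u * expMoment n (I * ω * linDenom β u) := by
  rw [rho, hankelIntegral, intervalIntegral.integral_of_le zero_le_one,
    setIntegral_congr_fun measurableSet_Ioc fun x hx => momentIntegrand_eq hω β n hx.1,
    integral_const_mul, integral_integral_swap (integrable_moment_kernel hω β n)]
  simp only [integral_kernel_eq]

/-! ### The substitution t = ωu and the β-derivatives of f_β -/

/-- The integrand `g(t/ω) t^{-1/2} e^{-t}` after the substitution `t = ω u`. -/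
noncomputable def scaledIntegrand (ω : ℝ) (g : ℝ → ℂ) (u : ℝ) : ℂ :=
  g u * (1 / (√u : ℝ)) * exp (-(ω * u))

theorem decayIntegrand_mul {ω : ℝ} (hω : 0 < ω) (g : ℝ → ℂ) (u : ℝ) :
    decayIntegrand (fun t => g (t / ω)) (u * ω) = (1 / (√ω : ℝ)) * scaledIntegrand ω g u := by
  rw [decayIntegrand, scaledIntegrand, Real.sqrt_mul' _ hω.le, mul_div_cancel_right₀ _ hω.ne']
  push_cast
  rw [mul_comm (u : ℂ)]
  ring

theorem integrableOn_decayIntegrand {ω : ℝ} (hω : 0 < ω) {g : ℝ → ℂ}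
    (hg : IntegrableOn (scaledIntegrand ω g) (Ioi 0)) :
    IntegrableOn (decayIntegrand fun t => g (t / ω)) (Ioi 0) := by
  have h := integrableOn_Ioi_comp_mul_right_iff (decayIntegrand fun t => g (t / ω)) 0 hω
  rw [zero_mul] at h
  refine h.1 ?_
  simp only [decayIntegrand_mul hω]
  exact hg.const_mul _

theorem decayIntegral_eq {ω : ℝ} (hω : 0 < ω) (g : ℝ → ℂ) :
    decayIntegral (fun t => g (t / ω)) =
      (√ω : ℝ) * ∫ u in Ioi (0 : ℝ), scaledIntegrand ω g u := by
  have h := integral_comp_mul_right_Ioi (decayIntegrand fun t => g (t / ω)) 0 hω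
  simp only [decayIntegrand_mul hω, zero_mul, integral_const_mul, Complex.real_smul] at h
  have hs := ofReal_sqrt_ne_zero hω
  have h2 := ofReal_sqrt_sq hω.le
  have hw : (ω : ℂ) ≠ 0 := by exact_mod_cast hω.ne'
  rw [decayIntegral]
  push_cast at h
  field_simp at h
  refine mul_left_cancel₀ hs ?_
  linear_combination (-1 : ℂ) * h - (∫ u in Ioi (0 : ℝ), scaledIntegrand ω g u) * h2

theorem integrableOn_rpow_mul_exp_neg {a ω : ℝ} (ha : -1 < a) (hω : 0 < ω) :
    IntegrableOn (fun u : ℝ => u ^ a * Real.exp (-(ω * u))) (Ioi 0) := by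
  simpa using integrableOn_rpow_mul_exp_neg_mul_rpow ha one_pos hω

theorem norm_scaledIntegrand (ω : ℝ) (g : ℝ → ℂ) {u : ℝ} (hu : 0 < u) :
    ‖scaledIntegrand ω g u‖ = ‖g u‖ * (u ^ (-(1 / 2) : ℝ) * Real.exp (-(ω * u))) := by
  rw [scaledIntegrand, norm_mul, norm_mul, norm_div, norm_one, Complex.norm_real,
    Real.norm_of_nonneg (Real.sqrt_nonneg u), Real.rpow_neg hu.le, ← Real.sqrt_eq_rpow,
    Complex.norm_exp]
  simp [mul_assoc]

theorem continuousOn_scaledIntegrand (ω : ℝ) {g : ℝ → ℂ} (hg : ContinuousOn g (Ioi 0)) :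
    ContinuousOn (scaledIntegrand ω g) (Ioi 0) := by
  unfold scaledIntegrand
  refine (hg.mul (continuousOn_const.div (by fun_prop) fun u hu => ofReal_sqrt_ne_zero hu)).mul
    (by fun_prop)

/-- Integrands of polynomial growth are absolutely integrable. -/
theorem integrableOn_scaledIntegrand {ω : ℝ} (hω : 0 < ω) {g : ℝ → ℂ} {C : ℝ} {k : ℕ}
    (hc : ContinuousOn g (Ioi 0)) (hg : ∀ u, 0 < u → ‖g u‖ ≤ C * (u ^ k * (2 + u))) :
    IntegrableOn (scaledIntegrand ω g) (Ioi 0) := by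
  have h1 := (integrableOn_rpow_mul_exp_neg (a := k + -(1 / 2))
    (by have : (0 : ℝ) ≤ k := k.cast_nonneg
        linarith) hω).const_mul 2
  have h2 := integrableOn_rpow_mul_exp_neg (a := (k + 1 : ℕ) + -(1 / 2))
    (by have : (0 : ℝ) ≤ (k + 1 : ℕ) := (k + 1).cast_nonneg
        linarith) hω
  refine Integrable.mono' ((h1.add h2).const_mul C)
    ((continuousOn_scaledIntegrand ω hc).aestronglyMeasurable measurableSet_Ioi) ?_
  filter_upwards [ae_restrict_mem measurableSet_Ioi] with u hu
  have hu' : (0 : ℝ) < u := hu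
  rw [norm_scaledIntegrand ω g hu']
  refine (mul_le_mul_of_nonneg_right (hg u hu') (by positivity)).trans (le_of_eq ?_)
  simp only [Pi.add_apply]
  rw [Real.rpow_add hu', Real.rpow_add hu', Real.rpow_natCast, Real.rpow_natCast]
  ring

theorem linDenom_ne_zero_of_pos (β : ℝ) {u : ℝ} (hu : 0 < u) : linDenom β u ≠ 0 := fun h => by
  have := linDenom_im β u
  rw [h] at this
  simp at this
  linarith

theorem le_norm_linDenom (β u : ℝ) : u ≤ ‖linDenom β u‖ := by
  have := (le_abs_self _).trans (Complex.abs_im_le_norm (linDenom β u))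
  rwa [linDenom_im] at this

theorem abs_le_norm_linDenom (β u : ℝ) : |1 + β| ≤ ‖linDenom β u‖ := by
  have := Complex.abs_re_le_norm (linDenom β u)
  rwa [linDenom_re] at this

theorem continuous_linDenom (β : ℝ) : Continuous (linDenom β) := by
  unfold linDenom
  fun_prop

theorem hasDerivAt_linDenom (β u : ℝ) : HasDerivAt (linDenom β) I u := by
  have := ((Complex.ofRealCLM.hasDerivAt (x := u)).const_mul I).const_add (1 + (β : ℂ))
  exact this.congr_deriv (by simp)

/-- The pole b = -w is off the real axis, so the formula holds at every real b and the induction may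
differentiate it as an identity of functions. -/
theorem iteratedDeriv_const_mul_inv (c : ℂ) {w : ℂ} (hw : w.im ≠ 0) (k : ℕ) :
    iteratedDeriv k (fun b : ℝ => c * ((b : ℂ) + w)⁻¹) =
      fun b : ℝ => (-1) ^ k * k.factorial * c * ((b : ℂ) + w)⁻¹ ^ (k + 1) := by
  induction k with
  | zero => simp
  | succ k ih =>
    rw [iteratedDeriv_succ, ih]
    funext b
    have hne : (b : ℂ) + w ≠ 0 := by
      intro h
      have := congrArg Complex.im h
      simp at this
      exact hw this
    have h1 : HasDerivAt (fun b : ℝ => (b : ℂ) + w) 1 b := by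
      simpa using (Complex.ofRealCLM.hasDerivAt (x := b)).add_const w
    have h2 := ((h1.fun_inv hne).fun_pow (k + 1)).const_mul ((-1) ^ k * (k.factorial : ℂ) * c)
    have e : (-1 : ℂ) / ((b : ℂ) + w) ^ 2 = -((b : ℂ) + w)⁻¹ ^ 2 := by
      rw [neg_div, one_div, inv_pow]
    rw [h2.deriv, Nat.factorial_succ, e, add_tsub_cancel_right]
    push_cast
    ring

theorem fBetaDeriv_eq (k : ℕ) (β : ℝ) {u : ℝ} (hu : 0 < u) :
    fBetaDeriv k β u = (-1) ^ k * k.factorial / (branchRoot u * linDenom β u ^ (k + 1)) := by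
  have h : (fun b : ℝ => fBeta b u) =
      fun b : ℝ => (branchRoot u)⁻¹ * ((b : ℂ) + (1 + I * u))⁻¹ := by
    funext b
    rw [fBeta, branchRoot, one_div, mul_inv]
    congr 2
    ring
  rw [fBetaDeriv, h, iteratedDeriv_const_mul_inv _ (by simpa using hu.ne'), linDenom]
  beta_reduce
  rw [show (β : ℂ) + (1 + I * u) = 1 + β + I * u by ring, div_eq_mul_inv, mul_inv, inv_pow]
  ring

theorem fBeta_eq (β u : ℝ) : fBeta β u = 1 / (branchRoot u * linDenom β u) := rfl

theorem linDenom_ne_zero {β : ℝ} (hβ : β ≠ -1) (u : ℝ) : linDenom β u ≠ 0 := fun h => by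
  have := linDenom_re β u
  rw [h] at this
  simp at this
  apply hβ
  linarith

theorem integrableOn_scaled_fBetaDeriv {ω β : ℝ} (hω : 0 < ω) (hβ : β ≠ -1) (k : ℕ) :
    IntegrableOn (scaledIntegrand ω (fBetaDeriv k β)) (Ioi 0) := by
  have hpos : 0 < |1 + β| := abs_pos.2 fun h => hβ (by linarith)
  refine integrableOn_scaledIntegrand hω (k := 0) (C := k.factorial / |1 + β| ^ (k + 1)) ?_ ?_
  · have h1 := continuous_branchRoot
    have h2 := continuous_linDenom β
    have : ContinuousOn (fun u => (-1) ^ k * (k.factorial : ℂ) /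
        (branchRoot u * linDenom β u ^ (k + 1))) (Ioi 0) := by
      refine ContinuousOn.div (by fun_prop) (by fun_prop) fun u _ =>
        mul_ne_zero (branchRoot_ne_zero u) (pow_ne_zero _ (linDenom_ne_zero hβ u))
    exact this.congr fun u hu => fBetaDeriv_eq k β hu
  · intro u hu
    rw [fBetaDeriv_eq k β hu, norm_div, norm_mul, norm_pow, norm_neg, norm_one, one_pow, one_mul,
      Complex.norm_natCast, norm_mul, norm_pow]
    have h1 := one_le_norm_branchRoot u
    have h2 := abs_le_norm_linDenom β u
    have h3 : |1 + β| ^ (k + 1) ≤ ‖linDenom β u‖ ^ (k + 1) := by gcongr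
    calc (k.factorial : ℝ) / (‖branchRoot u‖ * ‖linDenom β u‖ ^ (k + 1))
        ≤ k.factorial / (1 * |1 + β| ^ (k + 1)) := by gcongr
      _ ≤ _ := by
        rw [one_mul, pow_zero, one_mul]
        exact le_mul_of_one_le_right (by positivity) (by linarith)

/-! ### Reduction of the moments for β ≠ -1 -/

/-- The integrals `∫₀^∞ u^{-1/2} (2i - u)^{-1/2} (1 + β + i u)^{-(k+1)} du`. -/
noncomputable def kernelMoment (β : ℝ) (k : ℕ) : ℂ :=
  ∫ u in Ioi (0 : ℝ), hankelKernel u / linDenom β u ^ (k + 1)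

theorem integrableOn_kernelMoment {β : ℝ} (hβ : β ≠ -1) (k : ℕ) :
    IntegrableOn (fun u => hankelKernel u / linDenom β u ^ (k + 1)) (Ioi 0) := by
  have hpos : 0 < |1 + β| := abs_pos.2 fun h => hβ (by linarith)
  have hc := continuousOn_hankelKernel
  refine integrableOn_Ioi_of_norm_le_rpow (a := -(1 / 2)) (b := -2)
    (C := (|1 + β| ^ (k + 1))⁻¹) (D := (|1 + β| ^ k)⁻¹) (by norm_num) (by norm_num) ?_ ?_ ?_
  · have h2 := continuous_linDenom β
    exact hc.div (by fun_prop) fun u _ => pow_ne_zero _ (linDenom_ne_zero hβ u)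
  · intro u hu _
    rw [norm_div, norm_pow, div_eq_inv_mul]
    have h2 := abs_le_norm_linDenom β u
    gcongr
    exact norm_hankelKernel_le_rpow hu
  · intro u hu
    have hu0 : 0 < u := by linarith
    rw [norm_div, norm_pow, div_eq_inv_mul, pow_succ, mul_inv]
    have h2 := abs_le_norm_linDenom β u
    have h3 := le_norm_linDenom β u
    calc _ ≤ (|1 + β| ^ k)⁻¹ * u⁻¹ * u⁻¹ := by
          gcongr
          exact norm_hankelKernel_le_inv hu0
      _ = _ := by
        rw [Real.rpow_neg hu0.le, mul_assoc, ← mul_inv, ← sq, Real.rpow_two]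

/-- The reduction of the moments of order at least one to the integrals with exponential decay. -/
theorem pow_mul_rho_eq {ω β : ℝ} (hω : 0 < ω) (hβ : β ≠ -1) (n : ℕ) (h : ℝ → ℂ)
    (hint : IntegrableOn (scaledIntegrand ω h) (Ioi 0))
    (hpt : ∀ u, 0 < u → (I * ω) ^ n * expMoment n (I * ω * linDenom β u) =
      (1 / (I * ω)) * (exp (I * ω * linDenom β u) * (branchRoot u * h u)
        - (-1) ^ n * n.factorial / linDenom β u ^ (n + 1))) :
    (I * ω) ^ n * rho ω β n = -(2 / (Real.pi : ℂ)) * (ω : ℂ)⁻¹ *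
      (I * ((ω ^ (-(1 / 2) : ℝ) : ℝ) : ℂ) * exp (I * (β + 1) * ω) *
        decayIntegral (fun t => h (t / ω)) - I * ((-1) ^ n * n.factorial * kernelMoment β n)) := by
  have hw : (ω : ℂ) ≠ 0 := by exact_mod_cast hω.ne'
  have hpi : (Real.pi : ℂ) ≠ 0 := by exact_mod_cast Real.pi_ne_zero
  have e : ∀ u ∈ Ioi (0 : ℝ), (I * ω) ^ n *
      (hankelKernel u * expMoment n (I * ω * linDenom β u)) =
      (1 / (I * ω)) * (exp (I * (β + 1) * ω) * scaledIntegrand ω h u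
        - (-1) ^ n * n.factorial * (hankelKernel u / linDenom β u ^ (n + 1))) := by
    intro u hu
    have h1 := ofReal_sqrt_ne_zero hu
    have h2 := branchRoot_ne_zero u
    have h3 : exp (I * ω * linDenom β u) = exp (I * (β + 1) * ω) * exp (-(ω * u)) := by
      rw [← Complex.exp_add, linDenom]
      congr 1
      linear_combination (ω * u : ℂ) * I_sq
    have h4 : hankelKernel u * branchRoot u = 1 / (√u : ℝ) := by
      rw [hankelKernel]
      field_simp
    rw [mul_left_comm, hpt u hu, scaledIntegrand, h3, ← h4]
    ring
  have hrw : (I * ω) ^ n * rho ω β n = 2 / Real.pi * ((1 / (I * ω)) *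
      (exp (I * (β + 1) * ω) * (∫ u in Ioi (0 : ℝ), scaledIntegrand ω h u)
        - (-1) ^ n * n.factorial * kernelMoment β n)) := by
    rw [rho_eq hω, mul_left_comm, ← integral_const_mul, setIntegral_congr_fun measurableSet_Ioi e,
      integral_const_mul, integral_sub (hint.const_mul _)
        ((integrableOn_kernelMoment hβ n).const_mul _), integral_const_mul, integral_const_mul,
      kernelMoment]
  have hsq : ((ω ^ (-(1 / 2) : ℝ) : ℝ) : ℂ) * (√ω : ℝ) = 1 := by
    rw [← ofReal_mul, Real.rpow_neg hω.le, ← Real.sqrt_eq_rpow,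
      inv_mul_cancel₀ (Real.sqrt_pos.2 hω).ne', ofReal_one]
  have hI : 1 / (I * (ω : ℂ)) = -I * (ω : ℂ)⁻¹ := by
    have := I_ne_zero
    field_simp
    rw [I_sq]
    ring
  rw [hrw, decayIntegral_eq hω, hI]
  linear_combination (2 / (Real.pi : ℂ) * (ω : ℂ)⁻¹ * I * exp (I * (β + 1) * ω) *
    (∫ u in Ioi (0 : ℝ), scaledIntegrand ω h u)) * hsq

theorem expMoment_zero {a : ℂ} (ha : a ≠ 0) : expMoment 0 a = (exp a - 1) / a := by
  rw [eq_div_iff ha, mul_comm, mul_expMoment_zero]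

theorem expMoment_succ {a : ℂ} (ha : a ≠ 0) (n : ℕ) :
    expMoment (n + 1) a = (exp a - (n + 1) * expMoment n a) / a := by
  rw [eq_div_iff ha, mul_comm, mul_expMoment_succ]

theorem fBetaDeriv_zero (β : ℝ) : fBetaDeriv 0 β = fBeta β := by
  funext u
  rw [fBetaDeriv, iteratedDeriv_zero]

theorem integrableOn_scaled_fBeta {ω β : ℝ} (hω : 0 < ω) (hβ : β ≠ -1) :
    IntegrableOn (scaledIntegrand ω (fBeta β)) (Ioi 0) := by
  rw [← fBetaDeriv_zero]
  exact integrableOn_scaled_fBetaDeriv hω hβ 0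

theorem rho_zero_eq {ω β : ℝ} (hω : 0 < ω) (hβ : β ≠ -1) :
    rho ω β 0 = -(2 / (Real.pi : ℂ)) * (ω : ℂ)⁻¹ *
      (I * ((ω ^ (-(1 / 2) : ℝ) : ℝ) : ℂ) * exp (I * (β + 1) * ω) *
        decayIntegral (fun t => fBeta β (t / ω)) - I * kernelMoment β 0) := by
  have hw : (ω : ℂ) ≠ 0 := by exact_mod_cast hω.ne'
  have h := pow_mul_rho_eq hω hβ 0 (fBeta β)
    (integrableOn_scaled_fBeta hω hβ) ?_
  · simpa using h
  · intro u hu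
    have h1 := branchRoot_ne_zero u
    have h2 := linDenom_ne_zero hβ u
    have hI := I_ne_zero
    rw [expMoment_zero (by simp [hI, hw, h2]), fBeta_eq]
    simp only [pow_zero, one_mul, Nat.factorial, Nat.cast_one, zero_add, pow_one]
    field_simp

theorem integrableOn_scaledIntegrand_add {ω : ℝ} {g h : ℝ → ℂ}
    (hg : IntegrableOn (scaledIntegrand ω g) (Ioi 0))
    (hh : IntegrableOn (scaledIntegrand ω h) (Ioi 0)) :
    IntegrableOn (scaledIntegrand ω fun u => g u + h u) (Ioi 0) := by
  refine (hg.add hh).congr (.of_forall fun u => ?_)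
  simp only [scaledIntegrand, Pi.add_apply]
  ring

theorem integrableOn_scaledIntegrand_const_mul {ω : ℝ} {g : ℝ → ℂ} (c : ℂ)
    (hg : IntegrableOn (scaledIntegrand ω g) (Ioi 0)) :
    IntegrableOn (scaledIntegrand ω fun u => c * g u) (Ioi 0) := by
  refine (hg.const_mul c).congr (.of_forall fun u => ?_)
  simp only [scaledIntegrand]
  ring

/-- Each factor iωx is a β-derivative of e^{iωβx}, so order n comes from applying ∂_β^n to (e^{iωL}
- 1)/(iωL) with L = 1 + β + iu. By the Leibniz rule the exponential part carries (iω + ∂_β)^n f_β;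
this explains the binomial coefficients here and at orders two and three. -/
theorem rho_one_eq {ω β : ℝ} (hω : 0 < ω) (hβ : β ≠ -1) :
    I * ω * rho ω β 1 = -(2 / (Real.pi : ℂ)) * (ω : ℂ)⁻¹ *
      (I * ((ω ^ (-(1 / 2) : ℝ) : ℝ) : ℂ) * exp (I * (β + 1) * ω) *
        decayIntegral (fun t => I * ω * fBeta β (t / ω) + fBetaDeriv 1 β (t / ω))
          + I * kernelMoment β 1) := by
  have hw : (ω : ℂ) ≠ 0 := by exact_mod_cast hω.ne'
  have h := pow_mul_rho_eq hω hβ 1 (fun u => I * ω * fBeta β u + fBetaDeriv 1 β u)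
    (integrableOn_scaledIntegrand_add
      (integrableOn_scaledIntegrand_const_mul _ (integrableOn_scaled_fBeta hω hβ))
      (integrableOn_scaled_fBetaDeriv hω hβ 1)) ?_
  · simpa using h
  · intro u hu
    have h1 := branchRoot_ne_zero u
    have h2 := linDenom_ne_zero hβ u
    have hI := I_ne_zero
    have ha : I * ω * linDenom β u ≠ 0 := by simp [hI, hw, h2]
    rw [expMoment_succ ha, expMoment_zero ha, fBeta_eq, fBetaDeriv_eq 1 β hu]
    simp only [Nat.factorial]
    push_cast
    field_simp
    ring

theorem rho_two_eq {ω β : ℝ} (hω : 0 < ω) (hβ : β ≠ -1) :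
    -(ω : ℂ) ^ 2 * rho ω β 2 = -(2 / (Real.pi : ℂ)) * (ω : ℂ)⁻¹ *
      (I * ((ω ^ (-(1 / 2) : ℝ) : ℝ) : ℂ) * exp (I * (β + 1) * ω) *
        decayIntegral (fun t => -(ω : ℂ) ^ 2 * fBeta β (t / ω)
          + 2 * I * ω * fBetaDeriv 1 β (t / ω) + fBetaDeriv 2 β (t / ω))
          - 2 * I * kernelMoment β 2) := by
  have hw : (ω : ℂ) ≠ 0 := by exact_mod_cast hω.ne'
  have h := pow_mul_rho_eq hω hβ 2 (fun u => -(ω : ℂ) ^ 2 * fBeta β u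
      + 2 * I * ω * fBetaDeriv 1 β u + fBetaDeriv 2 β u)
    (integrableOn_scaledIntegrand_add (integrableOn_scaledIntegrand_add
      (integrableOn_scaledIntegrand_const_mul _ (integrableOn_scaled_fBeta hω hβ))
      (integrableOn_scaledIntegrand_const_mul _ (integrableOn_scaled_fBetaDeriv hω hβ 1)))
      (integrableOn_scaled_fBetaDeriv hω hβ 2)) ?_
  · have e : (I * (ω : ℂ)) ^ 2 = -(ω : ℂ) ^ 2 := by rw [mul_pow, I_sq]; ring
    rw [e] at h
    rw [h]
    simp only [Nat.factorial]
    push_cast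
    ring
  · intro u hu
    have h1 := branchRoot_ne_zero u
    have h2 := linDenom_ne_zero hβ u
    have hI := I_ne_zero
    have ha : I * ω * linDenom β u ≠ 0 := by simp [hI, hw, h2]
    have e : -(ω : ℂ) ^ 2 = I ^ 2 * ω ^ 2 := by rw [I_sq]; ring
    rw [expMoment_succ ha, expMoment_succ ha, expMoment_zero ha, fBeta_eq, fBetaDeriv_eq 1 β hu,
      fBetaDeriv_eq 2 β hu, e]
    simp only [Nat.factorial, Nat.cast_one, Nat.cast_zero, Nat.succ_eq_add_one]
    push_cast
    field_simp
    ring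

theorem rho_three_eq {ω β : ℝ} (hω : 0 < ω) (hβ : β ≠ -1) :
    -I * (ω : ℂ) ^ 3 * rho ω β 3 = -(2 / (Real.pi : ℂ)) * (ω : ℂ)⁻¹ *
      (I * ((ω ^ (-(1 / 2) : ℝ) : ℝ) : ℂ) * exp (I * (β + 1) * ω) *
        decayIntegral (fun t => -I * (ω : ℂ) ^ 3 * fBeta β (t / ω)
          - 3 * (ω : ℂ) ^ 2 * fBetaDeriv 1 β (t / ω)
          + 3 * I * ω * fBetaDeriv 2 β (t / ω) + fBetaDeriv 3 β (t / ω))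
          + 6 * I * kernelMoment β 3) := by
  have hw : (ω : ℂ) ≠ 0 := by exact_mod_cast hω.ne'
  have h := pow_mul_rho_eq hω hβ 3 (fun u => -I * (ω : ℂ) ^ 3 * fBeta β u
          + -(3 * (ω : ℂ) ^ 2) * fBetaDeriv 1 β u
          + 3 * I * ω * fBetaDeriv 2 β u + fBetaDeriv 3 β u)
    (integrableOn_scaledIntegrand_add (integrableOn_scaledIntegrand_add
      (integrableOn_scaledIntegrand_add
      (integrableOn_scaledIntegrand_const_mul _ (integrableOn_scaled_fBeta hω hβ))
      (integrableOn_scaledIntegrand_const_mul _ (integrableOn_scaled_fBetaDeriv hω hβ 1)))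
      (integrableOn_scaledIntegrand_const_mul _ (integrableOn_scaled_fBetaDeriv hω hβ 2)))
      (integrableOn_scaled_fBetaDeriv hω hβ 3)) ?_
  · have e : (I * (ω : ℂ)) ^ 3 = -I * (ω : ℂ) ^ 3 := by rw [mul_pow, I_pow_three]
    rw [e] at h
    rw [h]
    simp only [Nat.factorial, neg_mul, ← sub_eq_add_neg]
    push_cast
    ring
  · intro u hu
    have h1 := branchRoot_ne_zero u
    have h2 := linDenom_ne_zero hβ u
    have hI := I_ne_zero
    have ha : I * ω * linDenom β u ≠ 0 := by simp [hI, hw, h2]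
    have e : -I * (ω : ℂ) ^ 3 = I ^ 3 * ω ^ 3 := by rw [I_pow_three]
    have e2 : -(3 * (ω : ℂ) ^ 2) = 3 * I ^ 2 * ω ^ 2 := by rw [I_sq]; ring
    rw [expMoment_succ ha, expMoment_succ ha, expMoment_succ ha, expMoment_zero ha, fBeta_eq,
      fBetaDeriv_eq 1 β hu, fBetaDeriv_eq 2 β hu, fBetaDeriv_eq 3 β hu, e, e2]
    simp only [Nat.factorial, Nat.cast_one, Nat.cast_zero, Nat.succ_eq_add_one]
    push_cast
    field_simp
    ring

/-! ### Recurrence and closed forms for the kernel moments -/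

theorem hasDerivAt_sqrt_mul_branchRoot_div (β : ℝ) (k : ℕ) {u : ℝ} (hu : 0 < u) :
    HasDerivAt (fun u : ℝ => ((√u : ℝ) : ℂ) * branchRoot u / linDenom β u ^ (k + 1))
      (I * hankelKernel u * (-k * linDenom β u ^ 2 + (2 * k + 1) * β * linDenom β u
        - (k + 1) * ((β : ℂ) ^ 2 - 1)) / linDenom β u ^ (k + 2)) u := by
  have h2 := linDenom_ne_zero_of_pos β hu
  refine ((hasDerivAt_sqrt_mul_branchRoot hu).div ((hasDerivAt_linDenom β u).fun_pow (k + 1))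
    (pow_ne_zero _ h2)).congr_deriv ?_
  rw [sqrt_mul_branchRoot_eq hu, add_tsub_cancel_right]
  -- Expanding the numerator in powers of L = 1 + β + iu rather than u turns the derivative into a
  -- combination of kernel/L^j, which is the recurrence.
  have e : (u : ℂ) = I * (1 + β - linDenom β u) := by
    rw [linDenom]
    linear_combination (u : ℂ) * I_sq
  generalize linDenom β u = q at *
  rw [e]
  push_cast
  field_simp
  rw [I_sq]
  ring

theorem tendsto_ratio_sqrt_mul_branchRoot_linDenom (β : ℝ) :
    Tendsto (fun u : ℝ => ((√u : ℝ) : ℂ) * branchRoot u / linDenom β u) atTop (𝓝 1) := by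
  have h1 : Tendsto (fun u : ℝ => linDenom β u / u) atTop (𝓝 I) := by
    have h2 : Tendsto (fun u : ℝ => ((((1 + β) / u : ℝ)) : ℂ)) atTop (𝓝 ((0 : ℝ) : ℂ)) :=
      (Complex.continuous_ofReal.tendsto _).comp (tendsto_const_nhds.div_atTop tendsto_id)
    have h3 := h2.add_const I
    rw [ofReal_zero, zero_add] at h3
    refine h3.congr' ?_
    filter_upwards [eventually_gt_atTop 0] with u hu
    have : (u : ℂ) ≠ 0 := by exact_mod_cast hu.ne'
    rw [linDenom]
    push_cast
    field_simp
  have h4 := tendsto_rootRatio.div h1 I_ne_zero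
  rw [div_self I_ne_zero] at h4
  refine h4.congr' ?_
  filter_upwards [eventually_gt_atTop 0] with u hu
  have h5 := ofReal_sqrt_sq hu.le
  have h6 := ofReal_sqrt_ne_zero hu
  have h7 := linDenom_ne_zero_of_pos β hu
  simp only [Pi.div_apply]
  rw [rootRatio, ← h5]
  field_simp

theorem tendsto_inv_linDenom (β : ℝ) : Tendsto (fun u : ℝ => (linDenom β u)⁻¹) atTop (𝓝 0) := by
  refine squeeze_zero_norm' ?_ tendsto_inv_atTop_zero
  filter_upwards [eventually_gt_atTop 0] with u hu
  rw [norm_inv]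
  exact inv_anti₀ hu (le_norm_linDenom β u)

theorem tendsto_sqrt_mul_branchRoot_div_zero {β : ℝ} (hβ : β ≠ -1) (k : ℕ) :
    Tendsto (fun u : ℝ => ((√u : ℝ) : ℂ) * branchRoot u / linDenom β u ^ (k + 1))
      (𝓝[>] 0) (𝓝 0) := by
  have h1 := ((continuous_linDenom β).tendsto 0).mono_left (nhdsWithin_le_nhds (s := Ioi 0))
  have h2 := tendsto_sqrt_mul_branchRoot_zero.div (h1.pow (k + 1))
    (pow_ne_zero _ (linDenom_ne_zero hβ 0))
  rwa [zero_div] at h2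

/-- The ratio √u √(2i-u)/L tends to 1, so the boundary term survives only for k = 0. It is the
inhomogeneity of the first recurrence; the later ones are homogeneous. -/
theorem tendsto_sqrt_mul_branchRoot_div_atTop (β : ℝ) (k : ℕ) :
    Tendsto (fun u : ℝ => ((√u : ℝ) : ℂ) * branchRoot u / linDenom β u ^ (k + 1))
      atTop (𝓝 (0 ^ k)) := by
  have h := (tendsto_ratio_sqrt_mul_branchRoot_linDenom β).mul ((tendsto_inv_linDenom β).pow k)
  rw [one_mul] at h
  refine h.congr fun u => ?_
  rw [pow_succ', div_mul_eq_div_div, div_eq_mul_inv _ (linDenom β u ^ k), inv_pow]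

theorem kernelMoment_recurrence_one {β : ℝ} (hβ : β ≠ -1) :
    β * kernelMoment β 0 - ((β : ℂ) ^ 2 - 1) * kernelMoment β 1 = -I := by
  have i0 := (integrableOn_kernelMoment hβ 0).const_mul (I * β)
  have i1 := (integrableOn_kernelMoment hβ 1).const_mul (I * ((β : ℂ) ^ 2 - 1))
  have key : ∫ u in Ioi (0 : ℝ), (I * β * (hankelKernel u / linDenom β u ^ (0 + 1))
      - I * ((β : ℂ) ^ 2 - 1) * (hankelKernel u / linDenom β u ^ (1 + 1))) = 0 ^ 0 - 0 := by
    refine integral_Ioi_eq_sub_of_tendsto (fun u hu => ?_) (i0.sub i1)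
      (tendsto_sqrt_mul_branchRoot_div_zero hβ 0) (tendsto_sqrt_mul_branchRoot_div_atTop β 0)
    refine (hasDerivAt_sqrt_mul_branchRoot_div β 0 hu).congr_deriv ?_
    have h2 := linDenom_ne_zero hβ u
    push_cast
    field_simp
    ring
  rw [integral_sub i0 i1, integral_const_mul, integral_const_mul] at key
  change I * β * kernelMoment β 0 - I * ((β : ℂ) ^ 2 - 1) * kernelMoment β 1 = 0 ^ 0 - 0 at key
  linear_combination (-I) * key + (β * kernelMoment β 0
    - ((β : ℂ) ^ 2 - 1) * kernelMoment β 1) * I_sq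

theorem kernelMoment_recurrence {β : ℝ} (hβ : β ≠ -1) (k : ℕ) :
    -(k + 1) * kernelMoment β k + (2 * k + 3) * β * kernelMoment β (k + 1)
      - (k + 2) * ((β : ℂ) ^ 2 - 1) * kernelMoment β (k + 2) = 0 := by
  have i0 := (integrableOn_kernelMoment hβ k).const_mul (I * -(k + 1))
  have i1 := (integrableOn_kernelMoment hβ (k + 1)).const_mul (I * ((2 * k + 3) * β))
  have i2 := (integrableOn_kernelMoment hβ (k + 2)).const_mul (I * ((k + 2) * ((β : ℂ) ^ 2 - 1)))
  have key : ∫ u in Ioi (0 : ℝ), (I * -(k + 1) * (hankelKernel u / linDenom β u ^ (k + 1))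
      + I * ((2 * k + 3) * β) * (hankelKernel u / linDenom β u ^ (k + 1 + 1))
      - I * ((k + 2) * ((β : ℂ) ^ 2 - 1)) * (hankelKernel u / linDenom β u ^ (k + 2 + 1)))
      = 0 ^ (k + 1) - 0 := by
    refine integral_Ioi_eq_sub_of_tendsto (fun u hu => ?_) ((i0.add i1).sub i2)
      (tendsto_sqrt_mul_branchRoot_div_zero hβ (k + 1))
      (tendsto_sqrt_mul_branchRoot_div_atTop β (k + 1))
    refine (hasDerivAt_sqrt_mul_branchRoot_div β (k + 1) hu).congr_deriv ?_
    have h2 := linDenom_ne_zero hβ u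
    push_cast
    field_simp
    ring
  rw [integral_sub (i0.fun_add i1) i2, integral_add i0 i1, integral_const_mul, integral_const_mul,
    integral_const_mul, zero_pow (Nat.succ_ne_zero k), sub_zero] at key
  simp only [kernelMoment]
  refine mul_left_cancel₀ I_ne_zero ?_
  linear_combination key

/-- The relation for κ² makes 2i - (1-κ²)u = 2iL/(β+1), so the logarithmic primitive differentiates
to a constant times kernel/L. The case κ = 1 would put its endpoint at a singularity, and κ = 0
makes it trivial. -/
theorem kernelMoment_zero {β : ℝ} {κ : ℂ} (hβ : β ≠ -1) (hre : 0 ≤ κ.re) (him : 0 ≤ κ.im)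
    (h0 : κ ≠ 0) (h1 : κ ≠ 1) (hκ : κ ^ 2 = ((β : ℂ) - 1) / (β + 1)) :
    I * κ * (β + 1) * kernelMoment β 0 = 2 * artanhC κ := by
  have hb : (β : ℂ) + 1 ≠ 0 := by
    intro h
    apply hβ
    have : β + 1 = 0 := by exact_mod_cast h
    linarith
  have i0 := (integrableOn_kernelMoment hβ 0).const_mul (I * κ * (β + 1))
  have key : ∫ u in Ioi (0 : ℝ), I * κ * (β + 1) * (hankelKernel u / linDenom β u ^ (0 + 1))
      = Complex.log ((1 + κ) / (1 - κ)) - 0 := by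
    refine integral_Ioi_eq_sub_of_tendsto (fun u hu => ?_) i0 (tendsto_logPrimitive_zero κ)
      (tendsto_logPrimitive_atTop hre him h0 h1)
    refine (hasDerivAt_logPrimitive hre him h0 hu).congr_deriv ?_
    have h2 := linDenom_ne_zero hβ u
    have e : 2 * I - (1 - κ ^ 2) * u = 2 * I * linDenom β u / (β + 1) := by
      rw [hκ, linDenom]
      field_simp
      linear_combination (-2 * (u : ℂ)) * I_sq
    have hI := I_ne_zero
    rw [e, zero_add, pow_one]
    field_simp
    rw [I_sq]
    ring
  rw [integral_const_mul, sub_zero] at key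
  rw [kernelMoment, key, artanhC]
  ring

theorem sqrt_re_nonneg (z : ℂ) : 0 ≤ (Complex.sqrt z).re := by
  rw [Complex.sqrt, cpow_inv_two_re]
  exact Real.sqrt_nonneg _

theorem sqrt_im_nonneg {z : ℂ} (hz : 0 ≤ z.im) : 0 ≤ (Complex.sqrt z).im := by
  rw [Complex.sqrt, cpow_inv_two_im_eq_sqrt hz]
  exact Real.sqrt_nonneg _

/-- The closed first quadrant meets its negative only at 0, so it contains at most one square root
of a given number. This settles the sign when principal roots are compared. -/
theorem eq_of_sq_eq_sq_of_nonneg {z w : ℂ} (h : z ^ 2 = w ^ 2) (hz1 : 0 ≤ z.re) (hz2 : 0 ≤ z.im)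
    (hw1 : 0 ≤ w.re) (hw2 : 0 ≤ w.im) : z = w := by
  rcases sq_eq_sq_iff_eq_or_eq_neg.1 h with h | h
  · exact h
  · have h1 := congrArg Complex.re h
    have h2 := congrArg Complex.im h
    simp only [neg_re, neg_im] at h1 h2
    exact Complex.ext (by linarith) (by linarith)

/-- The zeroth kernel moment in terms of the principal inverse hyperbolic tangent. -/
theorem kernelMoment_zero_eq {β : ℝ} (h1 : β ≠ 1) (h2 : β ≠ -1) :
    I * kernelMoment β 0 = (if -1 < β then 1 else -1) *
      (2 * artanhTerm β / Complex.sqrt ((β : ℂ) ^ 2 - 1)) := by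
  set κ := Complex.sqrt (((β : ℂ) - 1) / ((β : ℂ) + 1)) with hκd
  have hb : (β : ℂ) + 1 ≠ 0 := by
    intro h
    apply h2
    have : β + 1 = 0 := by exact_mod_cast h
    linarith
  have hb' : (β : ℂ) - 1 ≠ 0 := by
    intro h
    apply h1
    have : β - 1 = 0 := by exact_mod_cast h
    linarith
  have hc : ((β : ℂ) - 1) / ((β : ℂ) + 1) = (((β - 1) / (β + 1) : ℝ) : ℂ) := by push_cast; rfl
  have hκ : κ ^ 2 = ((β : ℂ) - 1) / (β + 1) := sq_sqrt _
  have hre : 0 ≤ κ.re := sqrt_re_nonneg _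
  have him : 0 ≤ κ.im := sqrt_im_nonneg (by rw [hc, ofReal_im])
  have hκ0 : κ ≠ 0 := by
    intro h
    rw [h, zero_pow two_ne_zero] at hκ
    exact div_ne_zero hb' hb hκ.symm
  have hκ1 : κ ≠ 1 := by
    intro h
    rw [h, one_pow, eq_div_iff hb] at hκ
    have : (2 : ℂ) = 0 := by linear_combination hκ
    norm_num at this
  have hM := kernelMoment_zero h2 hre him hκ0 hκ1 hκ
  rw [artanhTerm, ← hκd]
  set S := Complex.sqrt ((β : ℂ) ^ 2 - 1) with hSd
  have hS : S ^ 2 = (β : ℂ) ^ 2 - 1 := sq_sqrt _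
  have hSre : 0 ≤ S.re := sqrt_re_nonneg _
  have hSim : 0 ≤ S.im := sqrt_im_nonneg (by
    rw [show (β : ℂ) ^ 2 - 1 = ((β ^ 2 - 1 : ℝ) : ℂ) by push_cast; rfl, ofReal_im])
  have hmul : (((β + 1 : ℝ) : ℂ) * κ) ^ 2 = (β : ℂ) ^ 2 - 1 := by
    rw [mul_pow, hκ]
    push_cast
    field_simp
    ring
  -- Both √(β²-1) and |β+1| κ are roots of β² - 1 in the closed first quadrant, hence equal.
  -- Replacing |β+1| by ±(β+1) is the source of the sign change at β = -1.
  split_ifs with hlt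
  · have hSκ : S = ((β + 1 : ℝ) : ℂ) * κ := by
      refine eq_of_sq_eq_sq_of_nonneg (hS.trans hmul.symm) hSre hSim ?_ ?_
      · rw [re_ofReal_mul]
        exact mul_nonneg (by linarith) hre
      · rw [im_ofReal_mul]
        exact mul_nonneg (by linarith) him
    rw [hSκ, ← hM]
    push_cast
    field_simp
  · have hSκ : S = ((-(β + 1) : ℝ) : ℂ) * κ := by
      refine eq_of_sq_eq_sq_of_nonneg (hS.trans ?_) hSre hSim ?_ ?_
      · rw [← hmul]
        push_cast
        ring
      · rw [re_ofReal_mul]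
        exact mul_nonneg (by linarith) hre
      · rw [im_ofReal_mul]
        exact mul_nonneg (by linarith) him
    rw [hSκ, ← hM]
    push_cast
    field_simp

theorem cpow_half_eq_sqrt_pow (z : ℂ) (n : ℕ) : z ^ ((n : ℂ) / 2) = Complex.sqrt z ^ n := by
  rw [div_eq_mul_inv, cpow_nat_mul, Complex.sqrt]

/-- At β = 1 the coefficient β² - 1 vanishes: the first recurrence gives the zeroth moment outright
and each later one is a two-term relation. No logarithm is needed. -/
theorem kernelMoment_at_one :
    kernelMoment 1 0 = -I ∧ kernelMoment 1 1 = -I / 3 ∧ kernelMoment 1 2 = -2 * I / 15 := by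
  have hβ : (1 : ℝ) ≠ -1 := by norm_num
  have h0 := kernelMoment_recurrence_one hβ
  have h1 := kernelMoment_recurrence hβ 0
  have h2 := kernelMoment_recurrence hβ 1
  push_cast at h0 h1 h2
  norm_num at h0 h1 h2
  have e1 : kernelMoment 1 1 = -I / 3 := by linear_combination h1 / 3 + h0 / 3
  exact ⟨h0, e1, by linear_combination h2 / 5 + 2 / 5 * e1⟩

/-- Odd powers of S = √(β²-1) equal S times powers of β² - 1. Running the recurrence down to the
zeroth moment then leaves rational identities in β and S, linear in the inverse hyperbolic tangent.
-/
theorem elem_eq_of_ne {β : ℝ} (h1 : β ≠ 1) (h2 : β ≠ -1) :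
    elem0 β = -I * kernelMoment β 0 ∧ elem1 β = I * kernelMoment β 1 ∧
      elem2 β = -2 * I * kernelMoment β 2 ∧ elem3 β = -6 * I * kernelMoment β 3 := by
  have hM := kernelMoment_zero_eq h1 h2
  have r1 := kernelMoment_recurrence_one h2
  have r2 := kernelMoment_recurrence h2 0
  have r3 := kernelMoment_recurrence h2 1
  push_cast at r2 r3
  have e3 : (3 / 2 : ℂ) = ((3 : ℕ) : ℂ) / 2 := by norm_num
  have e5 : (5 / 2 : ℂ) = ((5 : ℕ) : ℂ) / 2 := by norm_num
  have e7 : (7 / 2 : ℂ) = ((7 : ℕ) : ℂ) / 2 := by norm_num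
  rw [elem0, elem1, elem2, elem3, e3, e5, e7, cpow_half_eq_sqrt_pow, cpow_half_eq_sqrt_pow,
    cpow_half_eq_sqrt_pow, if_neg h1, if_neg h1, if_neg h1]
  set S := Complex.sqrt ((β : ℂ) ^ 2 - 1) with hSd
  have hS : S ^ 2 = (β : ℂ) ^ 2 - 1 := sq_sqrt _
  have hD : (β : ℂ) ^ 2 - 1 ≠ 0 := by
    intro h
    have h3 : (β - 1) * (β + 1) = 0 := by
      have : β ^ 2 - 1 = 0 := by exact_mod_cast h
      linarith
    rcases mul_eq_zero.1 h3 with h4 | h4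
    · exact h1 (by linarith)
    · exact h2 (by linarith)
  have hD' : 1 - (β : ℂ) ^ 2 ≠ 0 := by
    intro h
    exact hD (by linear_combination -h)
  have p3 : S ^ 3 = ((β : ℂ) ^ 2 - 1) * S := by rw [pow_succ, hS]
  have p5 : S ^ 5 = ((β : ℂ) ^ 2 - 1) ^ 2 * S := by
    rw [← hS]; ring
  have p7 : S ^ 7 = ((β : ℂ) ^ 2 - 1) ^ 3 * S := by
    rw [← hS]; ring
  have hS0 : S ≠ 0 := by
    intro h
    rw [h, zero_pow two_ne_zero] at hS
    exact hD hS.symm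
  have q1 : I * kernelMoment β 1 = (β * (I * kernelMoment β 0) - 1) / ((β : ℂ) ^ 2 - 1) := by
    rw [eq_div_iff hD]
    linear_combination (-I) * r1 + I_sq
  have q2 : 2 * (I * kernelMoment β 2) =
      (3 * β * (I * kernelMoment β 1) - I * kernelMoment β 0) / ((β : ℂ) ^ 2 - 1) := by
    rw [eq_div_iff hD]
    linear_combination (-I) * r2
  have q3 : 3 * (I * kernelMoment β 3) =
      (5 * β * (I * kernelMoment β 2) - 2 * (I * kernelMoment β 1)) / ((β : ℂ) ^ 2 - 1) := by
    rw [eq_div_iff hD]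
    linear_combination (-I) * r3
  have t2 : I * kernelMoment β 2 =
      (3 * β * (I * kernelMoment β 1) - I * kernelMoment β 0) / ((β : ℂ) ^ 2 - 1) / 2 := by
    rw [← q2]; ring
  rw [p3, p5, p7, show -6 * I * kernelMoment β 3 = -2 * (3 * (I * kernelMoment β 3)) by ring, q3,
    show -2 * I * kernelMoment β 2 = -2 * (I * kernelMoment β 2) by ring, t2, q1,
    show -I * kernelMoment β 0 = -(I * kernelMoment β 0) by ring, hM]
  generalize artanhTerm β = T
  split_ifs with hlt
  all_goals
    refine ⟨?_, ?_, ?_, ?_⟩ <;> field_simp <;> ring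

theorem elem_eq {β : ℝ} (h2 : β ≠ -1) :
    elem0 β = -I * kernelMoment β 0 ∧ elem1 β = I * kernelMoment β 1 ∧
      elem2 β = -2 * I * kernelMoment β 2 := by
  by_cases h1 : β = 1
  · obtain ⟨e0, e1, e2⟩ := kernelMoment_at_one
    rw [h1, e0, e1, e2, elem0, elem1, elem2, if_pos rfl, if_pos rfl, if_pos rfl]
    refine ⟨?_, ?_, ?_⟩
    · linear_combination -I_sq
    · linear_combination I_sq / 3
    · linear_combination (-4 / 15 : ℂ) * I_sq
  · obtain ⟨e0, e1, e2, -⟩ := elem_eq_of_ne h1 h2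
    exact ⟨e0, e1, e2⟩

/-! ### The case β = -1 -/

/-- The lower incomplete gamma function `∫₀^y xⁿ e^{-x} dx`, through its recurrence. -/
noncomputable def lowerGamma : ℕ → ℝ → ℂ
  | 0, y => 1 - exp (-(y : ℂ))
  | n + 1, y => (n + 1) * lowerGamma n y - (y : ℂ) ^ (n + 1) * exp (-(y : ℂ))

theorem hasDerivAt_exp_neg_ofReal (y : ℝ) :
    HasDerivAt (fun y : ℝ => exp (-(y : ℂ))) (-exp (-(y : ℂ))) y := by
  have := hasDerivAt_exp_mul_ofReal (-1) y
  simpa using this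

theorem hasDerivAt_lowerGamma (n : ℕ) (y : ℝ) :
    HasDerivAt (lowerGamma n) ((y : ℂ) ^ n * exp (-(y : ℂ))) y := by
  have he := hasDerivAt_exp_neg_ofReal y
  induction n with
  | zero => exact (he.const_sub 1).congr_deriv (by simp)
  | succ n ih =>
    have h1 : HasDerivAt (fun x : ℝ => (x : ℂ) ^ (n + 1)) ((n + 1) * (y : ℂ) ^ n) y := by
      simpa using (Complex.ofRealCLM.hasDerivAt (x := y)).fun_pow (n + 1)
    refine ((ih.const_mul ((n : ℂ) + 1)).sub (h1.mul he)).congr_deriv ?_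
    ring

theorem tendsto_lowerGamma (n : ℕ) : Tendsto (lowerGamma n) atTop (𝓝 n.factorial) := by
  have he : ∀ k : ℕ, Tendsto (fun y : ℝ => (y : ℂ) ^ k * exp (-(y : ℂ))) atTop (𝓝 0) := by
    intro k
    have h := (Complex.continuous_ofReal.tendsto _).comp
      (Real.tendsto_pow_mul_exp_neg_atTop_nhds_zero k)
    rw [ofReal_zero] at h
    refine h.congr fun y => ?_
    simp
  induction n with
  | zero =>
    have := (he 0).const_sub 1
    simp only [pow_zero, one_mul, sub_zero] at this
    simpa [lowerGamma] using this
  | succ n ih =>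
    have := (ih.const_mul ((n : ℂ) + 1)).sub (he (n + 1))
    rw [sub_zero] at this
    rw [Nat.factorial_succ]
    push_cast
    exact this

/-- The recurrence form gives the derivative and the limit n! at infinity; this form exhibits the
zero of order n + 1 at the origin. The integration by parts uses both. -/
theorem lowerGamma_eq (n : ℕ) (y : ℝ) :
    lowerGamma n y = (y : ℂ) ^ (n + 1) * expMoment n (-(y : ℂ)) := by
  induction n with
  | zero =>
    have := mul_expMoment_zero (-(y : ℂ))
    rw [lowerGamma, zero_add, pow_one]
    linear_combination this
  | succ n ih =>
    have := mul_expMoment_succ n (-(y : ℂ))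
    rw [lowerGamma, ih]
    linear_combination (y : ℂ) ^ (n + 1) * this

theorem norm_expMoment_neg_le (n : ℕ) {y : ℝ} (hy : 0 ≤ y) : ‖expMoment n (-(y : ℂ))‖ ≤ 1 := by
  have h := intervalIntegral.norm_integral_le_of_norm_le_const (a := 0) (b := 1) (C := 1)
    (f := fun x : ℝ => (x : ℂ) ^ n * exp (-(y : ℂ) * x)) ?_
  · simpa [expMoment] using h
  · intro x hx
    rw [uIoc_of_le zero_le_one] at hx
    rw [norm_mul, norm_pow, Complex.norm_real, Real.norm_of_nonneg hx.1.le, Complex.norm_exp]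
    refine mul_le_one₀ (pow_le_one₀ hx.1.le hx.2) (Real.exp_pos _).le ?_
    rw [Real.exp_le_one_iff]
    simp
    exact mul_nonneg hy hx.1.le

/-- The integrands `√(2i - t/ω) (t/ω)^k` are absolutely integrable. -/
theorem integrableOn_scaled_branchRoot_mul_pow {ω : ℝ} (hω : 0 < ω) (k : ℕ) :
    IntegrableOn (scaledIntegrand ω fun u => branchRoot u * (u : ℂ) ^ k) (Ioi 0) := by
  have h := continuous_branchRoot
  refine integrableOn_scaledIntegrand hω (k := k) (C := 1)
    (Continuous.continuousOn (by fun_prop)) fun u hu => ?_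
  rw [norm_mul, norm_pow, Complex.norm_real, Real.norm_of_nonneg hu.le, one_mul, mul_comm]
  gcongr
  exact norm_branchRoot_le hu.le

/-- Integration by parts for `β = -1`: if `√(2i-u) u^{-n-1/2} R(u)` is a primitive of
`u^{-n-3/2} (2i-u)^{-1/2}`, then the `n`-th moment reduces to an integral with exponential decay. -/
theorem rho_neg_one_eq {ω : ℝ} (hω : 0 < ω) (n : ℕ) {R : ℝ → ℂ} {ℓ : ℂ} (hRc : Continuous R)
    (hR : ∀ u, 0 < u → HasDerivAt (fun u : ℝ => rootRatio u * (R u / (u : ℂ) ^ n))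
      (hankelKernel u / (u : ℂ) ^ (n + 1)) u)
    (hRint : IntegrableOn (scaledIntegrand ω fun u => branchRoot u * R u) (Ioi 0))
    (hRlim : Tendsto (fun u : ℝ => R u / (u : ℂ) ^ n) atTop (𝓝 ℓ)) :
    rho ω (-1) n = 2 / Real.pi * (I * ℓ * n.factorial / (ω : ℂ) ^ (n + 1)
      - ((ω ^ (-(1 / 2) : ℝ) : ℝ) : ℂ) * decayIntegral fun t =>
        Complex.sqrt (2 * I - (t / ω : ℝ)) * R (t / ω)) := by
  have hw : (ω : ℂ) ≠ 0 := by exact_mod_cast hω.ne'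
  have harg : ∀ u : ℝ, I * ω * linDenom (-1) u = -((ω * u : ℝ) : ℂ) := by
    intro u
    rw [linDenom]
    push_cast
    linear_combination (ω * u : ℂ) * I_sq
  have i1 := (integrableOn_kernel_mul_expMoment hω (-1) n).const_mul ((ω : ℂ) ^ (n + 1))
  have i2 := hRint.const_mul ((ω : ℂ) ^ (n + 1))
  have key : ∫ u in Ioi (0 : ℝ), ((ω : ℂ) ^ (n + 1) *
      (hankelKernel u * expMoment n (I * ω * linDenom (-1) u)) +
      (ω : ℂ) ^ (n + 1) * scaledIntegrand ω (fun u => branchRoot u * R u) u)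
      = I * ℓ * n.factorial - 0 := by
    -- At 0 the zero of order n + 1 of the incomplete gamma function outweighs the singularity
    -- u^{-n-1/2}. At infinity the three factors tend to i, ℓ and n!, which gives the elementary
    -- term.
    refine integral_Ioi_eq_sub_of_tendsto
      (f := fun u : ℝ => rootRatio u * (R u / (u : ℂ) ^ n) * lowerGamma n (ω * u))
      (fun u hu => ?_) (i1.add i2) ?_ ?_
    · have hu0 : (u : ℂ) ≠ 0 := by exact_mod_cast (ne_of_gt hu)
      have hg : HasDerivAt (fun u : ℝ => lowerGamma n (ω * u))
          (ω * (((ω * u : ℝ) : ℂ) ^ n * exp (-((ω * u : ℝ) : ℂ)))) u := by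
        have h1 : HasDerivAt (fun u : ℝ => ω * u) ω u := by
          simpa using (hasDerivAt_id u).const_mul ω
        have := HasDerivAt.scomp u (hasDerivAt_lowerGamma n (ω * u)) h1
        rwa [Complex.real_smul] at this
      refine ((hR u hu).mul hg).congr_deriv ?_
      have h1 := ofReal_sqrt_ne_zero hu
      rw [lowerGamma_eq, harg, scaledIntegrand, rootRatio]
      push_cast
      field_simp
      ring
    · have hc : Tendsto (fun u : ℝ => ‖(ω : ℂ) ^ (n + 1) * ((√u : ℝ) * branchRoot u) * R u‖)
          (𝓝[>] 0) (𝓝 0) := by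
        have h1 := ((tendsto_sqrt_mul_branchRoot_zero.const_mul ((ω : ℂ) ^ (n + 1))).mul
          ((hRc.tendsto 0).mono_left (nhdsWithin_le_nhds (s := Ioi 0)))).norm
        simpa using h1
      refine squeeze_zero_norm' ?_ hc
      filter_upwards [self_mem_nhdsWithin] with u hu
      have hu' : (0 : ℝ) < u := hu
      have hu0 : (u : ℂ) ≠ 0 := by exact_mod_cast hu'.ne'
      have h1 := ofReal_sqrt_ne_zero hu
      have h2 := ofReal_sqrt_sq hu'.le
      have e : rootRatio u * (R u / (u : ℂ) ^ n) * lowerGamma n (ω * u) =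
          (ω : ℂ) ^ (n + 1) * ((√u : ℝ) * branchRoot u) * R u *
            expMoment n (-((ω * u : ℝ) : ℂ)) := by
        have e2 : ((√u : ℝ) : ℂ) * branchRoot u = rootRatio u * u := by
          rw [rootRatio, ← h2]
          field_simp
        rw [lowerGamma_eq, e2]
        push_cast
        field_simp
        ring
      rw [e, norm_mul]
      exact mul_le_of_le_one_right (norm_nonneg _) (norm_expMoment_neg_le n (by positivity))
    · exact (tendsto_rootRatio.mul hRlim).mul
        ((tendsto_lowerGamma n).comp (tendsto_id.const_mul_atTop hω))
  rw [integral_add i1 i2, integral_const_mul, integral_const_mul, sub_zero] at key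
  have hsq : ((ω ^ (-(1 / 2) : ℝ) : ℝ) : ℂ) * (√ω : ℝ) = 1 := by
    rw [← ofReal_mul, Real.rpow_neg hω.le, ← Real.sqrt_eq_rpow,
      inv_mul_cancel₀ (Real.sqrt_pos.2 hω).ne', ofReal_one]
  have hdec := decayIntegral_eq hω (fun u => branchRoot u * R u)
  simp only [branchRoot] at hdec
  rw [rho_eq hω, hdec, ← mul_assoc ((ω ^ (-(1 / 2) : ℝ) : ℝ) : ℂ), hsq, one_mul, ← key]
  simp only [branchRoot]
  field_simp
  ring

theorem hasDerivAt_rootRatio {u : ℝ} (hu : 0 < u) :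
    HasDerivAt rootRatio (-I * hankelKernel u / u) u := by
  refine ((hasDerivAt_branchRoot u).div (hasDerivAt_ofReal_sqrt hu) (ofReal_sqrt_ne_zero hu)
    ).congr_deriv ?_
  have h0 : (u : ℂ) ≠ 0 := by exact_mod_cast hu.ne'
  have h1 := ofReal_sqrt_ne_zero hu
  have h2 := branchRoot_ne_zero u
  have h3 := ofReal_sqrt_sq hu.le
  have h4 := branchRoot_sq u
  rw [hankelKernel]
  field_simp
  rw [h3, h4]
  ring

theorem rootRatio_eq {u : ℝ} (hu : 0 < u) : rootRatio u = (2 * I - u) * hankelKernel u := by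
  have h1 := ofReal_sqrt_ne_zero hu
  have h2 := branchRoot_ne_zero u
  rw [rootRatio, hankelKernel, ← branchRoot_sq]
  field_simp

theorem hasDerivAt_ofReal_coe (u : ℝ) : HasDerivAt (fun u : ℝ => (u : ℂ)) 1 u := by
  exact (Complex.ofRealCLM.hasDerivAt (x := u)).congr_deriv (by simp)

theorem integrableOn_scaled_branchRoot {ω : ℝ} (hω : 0 < ω) :
    IntegrableOn (scaledIntegrand ω branchRoot) (Ioi 0) := by
  simpa using integrableOn_scaled_branchRoot_mul_pow hω 0

theorem tendsto_const_div_ofReal (c : ℂ) :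
    Tendsto (fun u : ℝ => c / (u : ℂ)) atTop (𝓝 0) := by
  have h := ((Complex.continuous_ofReal.tendsto _).comp tendsto_inv_atTop_zero).const_mul c
  rw [ofReal_zero, mul_zero] at h
  refine h.congr fun u => ?_
  simp [div_eq_mul_inv]

theorem decayIntegral_const_mul (c : ℂ) (g : ℝ → ℂ) :
    decayIntegral (fun t => c * g t) = c * decayIntegral g := by
  rw [decayIntegral, decayIntegral, ← integral_const_mul]
  simp only [decayIntegrand, mul_assoc]

/-- The primitive condition amounts to -iR + (2i-u)(uR' - nR) = 1, solved here by a polynomial R of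
degree n: i for n = 0, (u+i)/3 for n = 1, and -i(2u²+2iu-3)/15 for n = 2. The boundary value ℓ is
the leading coefficient. -/
theorem rho_neg_one_zero {ω : ℝ} (hω : 0 < ω) :
    rho ω (-1) 0 = 2 / Real.pi * (-1 / (ω : ℂ) - I * ((ω ^ (-(1 / 2) : ℝ) : ℝ) : ℂ) *
      decayIntegral fun t => Complex.sqrt (2 * I - t / ω)) := by
  have hint := integrableOn_scaledIntegrand_const_mul I (integrableOn_scaled_branchRoot hω)
  simp only [mul_comm I] at hint
  have h := rho_neg_one_eq hω 0 (R := fun _ => I) (ℓ := I) continuous_const ?_ hint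
    (by simp)
  · simp only [mul_comm _ I] at h
    rw [h, decayIntegral_const_mul]
    simp only [zero_add, pow_one, Nat.factorial, Nat.cast_one, mul_one, I_mul_I, mul_comm I 2]
    push_cast
    ring
  · intro u hu
    have h0 : (u : ℂ) ≠ 0 := by exact_mod_cast hu.ne'
    simp only [pow_zero, div_one]
    refine ((hasDerivAt_rootRatio hu).mul_const I).congr_deriv ?_
    field_simp
    rw [I_sq]
    ring

theorem rho_neg_one_one {ω : ℝ} (hω : 0 < ω) :
    rho ω (-1) 1 = 2 / Real.pi * (I / 3 / (ω : ℂ) ^ 2 + ((ω ^ (-(1 / 2) : ℝ) : ℝ) : ℂ) / 3 *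
      decayIntegral fun t => (-I - t / ω) * Complex.sqrt (2 * I - t / ω)) := by
  have hint : IntegrableOn (scaledIntegrand ω fun u => branchRoot u * ((u + I) / 3)) (Ioi 0) := by
    have h0 := integrableOn_scaledIntegrand_const_mul (I / 3) (integrableOn_scaled_branchRoot hω)
    have h1 := integrableOn_scaledIntegrand_const_mul (1 / 3)
      (integrableOn_scaled_branchRoot_mul_pow hω 1)
    convert integrableOn_scaledIntegrand_add h0 h1 using 2
    funext u
    ring
  have h := rho_neg_one_eq hω 1 (R := fun u => (u + I) / 3) (ℓ := 1 / 3) (by fun_prop) ?_ hint ?_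
  · have e : (fun t : ℝ => Complex.sqrt (2 * I - (t / ω : ℝ)) * (((t / ω : ℝ) + I) / 3)) =
        fun t : ℝ => (-1 / 3) * ((-I - t / ω) * Complex.sqrt (2 * I - t / ω)) := by
      funext t
      push_cast
      ring
    rw [h, e, decayIntegral_const_mul]
    simp only [Nat.factorial]
    push_cast
    ring
  · intro u hu
    have h0 : (u : ℂ) ≠ 0 := by exact_mod_cast hu.ne'
    refine ((hasDerivAt_rootRatio hu).mul ((((hasDerivAt_ofReal_coe u).add_const I).div_const 3).div
      ((hasDerivAt_ofReal_coe u).fun_pow 1) (pow_ne_zero _ h0))).congr_deriv ?_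
    rw [rootRatio_eq hu]
    simp only [Pi.div_apply]
    push_cast
    field_simp
    ring_nf
    simp only [I_sq]
    ring
  · have h2 := (tendsto_const_div_ofReal (I / 3)).const_add (1 / 3)
    rw [add_zero] at h2
    refine h2.congr' ?_
    filter_upwards [eventually_gt_atTop 0] with u hu
    have h0 : (u : ℂ) ≠ 0 := by exact_mod_cast hu.ne'
    field_simp

theorem rho_neg_one_two {ω : ℝ} (hω : 0 < ω) :
    rho ω (-1) 2 = 2 / Real.pi * (4 / 15 / (ω : ℂ) ^ 3 + ((ω ^ (-(1 / 2) : ℝ) : ℝ) : ℂ) * (I / 15) *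
      decayIntegral fun t => Complex.sqrt (2 * I - t / ω) *
          (2 * ((t : ℂ) / ω) ^ 2 + 2 * I * t / ω - 3)) := by
  have hint : IntegrableOn (scaledIntegrand ω fun u => branchRoot u *
      (-I / 15 * (2 * (u : ℂ) ^ 2 + 2 * I * u - 3))) (Ioi 0) := by
    have h0 := integrableOn_scaledIntegrand_const_mul (I / 5) (integrableOn_scaled_branchRoot hω)
    have h1 := integrableOn_scaledIntegrand_const_mul (-2 * I ^ 2 / 15)
      (integrableOn_scaled_branchRoot_mul_pow hω 1)
    have h2 := integrableOn_scaledIntegrand_const_mul (-2 * I / 15)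
      (integrableOn_scaled_branchRoot_mul_pow hω 2)
    convert integrableOn_scaledIntegrand_add (integrableOn_scaledIntegrand_add h0 h1) h2 using 2
    funext u
    ring
  have h := rho_neg_one_eq hω 2 (R := fun u => -I / 15 * (2 * (u : ℂ) ^ 2 + 2 * I * u - 3))
    (ℓ := -2 * I / 15) (by fun_prop) ?_ hint ?_
  · have e : (fun t : ℝ => Complex.sqrt (2 * I - (t / ω : ℝ)) *
          (-I / 15 * (2 * ((t / ω : ℝ) : ℂ) ^ 2 + 2 * I * (t / ω : ℝ) - 3))) =
        fun t : ℝ => (-I / 15) * (Complex.sqrt (2 * I - t / ω) *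
          (2 * ((t : ℂ) / ω) ^ 2 + 2 * I * t / ω - 3)) := by
      funext t
      push_cast
      ring
    rw [h, e, decayIntegral_const_mul]
    simp only [Nat.factorial]
    push_cast
    ring_nf
    simp only [I_sq]
    ring
  · intro u hu
    have h0 : (u : ℂ) ≠ 0 := by exact_mod_cast hu.ne'
    refine ((hasDerivAt_rootRatio hu).mul (((((((hasDerivAt_ofReal_coe u).fun_pow 2).const_mul 2).add
      ((hasDerivAt_ofReal_coe u).const_mul (2 * I))).sub_const 3).const_mul (-I / 15)).div
      ((hasDerivAt_ofReal_coe u).fun_pow 2) (pow_ne_zero _ h0))).congr_deriv ?_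
    rw [rootRatio_eq hu]
    simp only [Pi.div_apply, Pi.add_apply]
    push_cast
    field_simp
    ring_nf
    simp only [I_sq, I_pow_three]
    ring
  · have h2 := ((tendsto_const_div_ofReal (-2 * I ^ 2 / 15)).add
      ((tendsto_const_div_ofReal (I / 5)).mul (tendsto_const_div_ofReal 1))).const_add (-2 * I / 15)
    rw [mul_zero, add_zero, add_zero] at h2
    refine h2.congr' ?_
    filter_upwards [eventually_gt_atTop 0] with u hu
    have h0 : (u : ℂ) ≠ 0 := by exact_mod_cast hu.ne'
    field_simp
    ring

theorem rpow_half_add {ω : ℝ} (hω : 0 < ω) (n : ℕ) {a : ℝ} (ha : a = -(1 / 2) + n) :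
    ((ω ^ a : ℝ) : ℂ) = ((ω ^ (-(1 / 2) : ℝ) : ℝ) : ℂ) * (ω : ℂ) ^ n := by
  rw [ha, Real.rpow_add hω, Real.rpow_natCast]
  push_cast
  ring

/-! ### Linearity, Chebyshev moments and assembly -/

theorem hankelIntegral_cubic {ω : ℝ} (hω : 0 < ω) (β : ℝ) (a b c d : ℂ) :
    hankelIntegral ω β (fun x => a * (x : ℂ) ^ 3 + b * (x : ℂ) ^ 2 + c * (x : ℂ) ^ 1
      + d * (x : ℂ) ^ 0) =
      a * rho ω β 3 + b * rho ω β 2 + c * rho ω β 1 + d * rho ω β 0 := by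
  have i (n : ℕ) := intervalIntegrable_momentIntegrand hω β n
  simp only [rho, hankelIntegral]
  simp only [← intervalIntegral.integral_const_mul]
  rw [← intervalIntegral.integral_add ((i 3).const_mul a) ((i 2).const_mul b),
    ← intervalIntegral.integral_add (((i 3).const_mul a).add ((i 2).const_mul b))
      ((i 1).const_mul c),
    ← intervalIntegral.integral_add ((((i 3).const_mul a).add ((i 2).const_mul b)).add
      ((i 1).const_mul c)) ((i 0).const_mul d)]
  refine intervalIntegral.integral_congr fun x _ => ?_
  simp only [momentIntegrand]
  ring

theorem sigma_eq_hankelIntegral (ω β : ℝ) (n : ℕ) {g : ℝ → ℂ}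
    (h : ∀ x : ℝ, (((Polynomial.Chebyshev.T ℝ (n : ℤ)).eval (2 * x - 1) : ℝ) : ℂ) = g x) :
    sigma ω β n = hankelIntegral ω β g := by
  rw [sigma]
  exact congrArg _ (funext h)

theorem sigma_zero (ω β : ℝ) : sigma ω β 0 = rho ω β 0 :=
  sigma_eq_hankelIntegral ω β 0 fun x => by simp

theorem sigma_one {ω : ℝ} (hω : 0 < ω) (β : ℝ) :
    sigma ω β 1 = 2 * rho ω β 1 - rho ω β 0 := by
  rw [sigma_eq_hankelIntegral ω β 1 (g := fun x => 0 * (x : ℂ) ^ 3 + 0 * (x : ℂ) ^ 2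
    + 2 * (x : ℂ) ^ 1 + (-1) * (x : ℂ) ^ 0) fun x => ?_, hankelIntegral_cubic hω]
  · ring
  · rw [Nat.cast_one, Polynomial.Chebyshev.T_one]
    simp
    ring

theorem sigma_two {ω : ℝ} (hω : 0 < ω) (β : ℝ) :
    sigma ω β 2 = 8 * rho ω β 2 - 8 * rho ω β 1 + rho ω β 0 := by
  rw [sigma_eq_hankelIntegral ω β 2 (g := fun x => 0 * (x : ℂ) ^ 3 + 8 * (x : ℂ) ^ 2
    + (-8) * (x : ℂ) ^ 1 + 1 * (x : ℂ) ^ 0) fun x => ?_, hankelIntegral_cubic hω]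
  · ring
  · rw [Nat.cast_ofNat, Polynomial.Chebyshev.T_two]
    simp
    ring

theorem sigma_three {ω : ℝ} (hω : 0 < ω) (β : ℝ) :
    sigma ω β 3 = 32 * rho ω β 3 - 48 * rho ω β 2 + 18 * rho ω β 1 - rho ω β 0 := by
  rw [sigma_eq_hankelIntegral ω β 3 (g := fun x => 32 * (x : ℂ) ^ 3 + (-48) * (x : ℂ) ^ 2
    + 18 * (x : ℂ) ^ 1 + (-1) * (x : ℂ) ^ 0) fun x => ?_, hankelIntegral_cubic hω]
  · ring
  · have h := Polynomial.Chebyshev.T_add_two ℝ 1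
    norm_num at h
    rw [show ((3 : ℕ) : ℤ) = 3 by norm_num, h, Polynomial.Chebyshev.T_two]
    simp
    ring

end HankelMoments

open HankelMoments in
theorem corollary3p3 (ω β : ℝ) (hω : 0 < ω) :
    -- all the integrals that occur converge absolutely
    (∀ n : ℕ, IntervalIntegrable (momentIntegrand ω β (fun x => (x : ℂ) ^ n)) volume 0 1) ∧
    (β ≠ -1 → ∀ k ≤ 3,
      IntegrableOn (decayIntegrand (fun t => fBetaDeriv k β (t / ω))) (Ioi 0)) ∧
    (∀ k ≤ 2, IntegrableOn
      (decayIntegrand (fun t => Complex.sqrt (2 * I - t / ω) * ((t : ℂ) / ω) ^ k)) (Ioi 0)) ∧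
    -- the moment of order zero
    rho ω β 0 = sigma ω β 0 ∧
    (β ≠ -1 → rho ω β 0 = -(2 / (Real.pi : ℂ)) * (ω : ℂ)⁻¹ *
      (I * ((ω ^ (-(1 / 2) : ℝ) : ℝ) : ℂ) * exp (I * (β + 1) * ω) *
        decayIntegral (fun t => fBeta β (t / ω))
      + elem0 β)) ∧
    (β = -1 → rho ω β 0 = -(2 / (Real.pi : ℂ)) * (ω : ℂ)⁻¹ *
      (I * ((ω ^ (1 / 2 : ℝ) : ℝ) : ℂ) *
        decayIntegral (fun t => Complex.sqrt (2 * I - t / ω))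
      + 1)) ∧
    -- the moment of order one
    (β ≠ -1 → I * ω * rho ω β 1 = -(2 / (Real.pi : ℂ)) * (ω : ℂ)⁻¹ *
      (I * ((ω ^ (-(1 / 2) : ℝ) : ℝ) : ℂ) * exp (I * (β + 1) * ω) *
        decayIntegral (fun t => I * ω * fBeta β (t / ω) + fBetaDeriv 1 β (t / ω))
      + elem1 β)) ∧
    (β = -1 → I * ω * rho ω β 1 = -(2 / (Real.pi : ℂ)) * (ω : ℂ)⁻¹ *
      (-(I / 3) * ((ω ^ (3 / 2 : ℝ) : ℝ) : ℂ) *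
        decayIntegral (fun t => (-I - t / ω) * Complex.sqrt (2 * I - t / ω))
      + 1 / 3)) ∧
    -- the moment of order two
    (β ≠ -1 → -(ω : ℂ) ^ 2 * rho ω β 2 = -(2 / (Real.pi : ℂ)) * (ω : ℂ)⁻¹ *
      (I * ((ω ^ (-(1 / 2) : ℝ) : ℝ) : ℂ) * exp (I * (β + 1) * ω) *
        decayIntegral (fun t => -(ω : ℂ) ^ 2 * fBeta β (t / ω)
          + 2 * I * ω * fBetaDeriv 1 β (t / ω) + fBetaDeriv 2 β (t / ω))
      + elem2 β)) ∧
    (β = -1 → -(ω : ℂ) ^ 2 * rho ω β 2 = -(2 / (Real.pi : ℂ)) * (ω : ℂ)⁻¹ *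
      (((ω ^ (5 / 2 : ℝ) : ℝ) : ℂ) * (I / 15) *
        decayIntegral (fun t => Complex.sqrt (2 * I - t / ω) *
          (2 * ((t : ℂ) / ω) ^ 2 + 2 * I * t / ω - 3))
      + 4 / 15)) ∧
    -- the moment of order three
    (β ≠ 1 → β ≠ -1 → -I * (ω : ℂ) ^ 3 * rho ω β 3 =
      -(2 * I / (Real.pi : ℂ)) * ((ω ^ (-(3 / 2) : ℝ) : ℝ) : ℂ) * exp (I * (β + 1) * ω) *
        decayIntegral (fun t => -I * (ω : ℂ) ^ 3 * fBeta β (t / ω)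
          - 3 * (ω : ℂ) ^ 2 * fBetaDeriv 1 β (t / ω)
          + 3 * I * ω * fBetaDeriv 2 β (t / ω) + fBetaDeriv 3 β (t / ω))
      + 2 / (Real.pi : ℂ) * (ω : ℂ)⁻¹ * elem3 β) ∧
    -- the initial Chebyshev moments
    sigma ω β 0 = rho ω β 0 ∧
    sigma ω β 1 = 2 * rho ω β 1 - rho ω β 0 ∧
    sigma ω β 2 = 8 * rho ω β 2 - 8 * rho ω β 1 + rho ω β 0 ∧
    sigma ω β 3 = 32 * rho ω β 3 - 48 * rho ω β 2 + 18 * rho ω β 1 - rho ω β 0 := by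
  have hwc : (ω : ℂ) ≠ 0 := by exact_mod_cast hω.ne'
  have hpi : (Real.pi : ℂ) ≠ 0 := by exact_mod_cast Real.pi_ne_zero
  have hσ0 : sigma ω β 0 = rho ω β 0 := sigma_zero ω β
  refine ⟨intervalIntegrable_momentIntegrand hω β, ?_, ?_, hσ0.symm, ?_, ?_, ?_, ?_, ?_, ?_, ?_,
    hσ0, sigma_one hω β, sigma_two hω β, sigma_three hω β⟩
  · intro hβ k _
    exact integrableOn_decayIntegrand hω (integrableOn_scaled_fBetaDeriv hω hβ k)
  · intro k _
    have h := integrableOn_decayIntegrand hω (integrableOn_scaled_branchRoot_mul_pow hω k)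
    simpa only [branchRoot, ofReal_div] using h
  · intro hβ
    rw [rho_zero_eq hω hβ, (elem_eq hβ).1]
    ring
  · intro hβ
    rw [hβ, rho_neg_one_zero hω, rpow_half_add hω 1 (by norm_num : (1 / 2 : ℝ) = _)]
    generalize decayIntegral _ = D
    field_simp
    ring
  · intro hβ
    rw [rho_one_eq hω hβ, (elem_eq hβ).2.1]
  · intro hβ
    rw [hβ, rho_neg_one_one hω, rpow_half_add hω 2 (by norm_num : (3 / 2 : ℝ) = _)]
    generalize decayIntegral _ = D
    field_simp
    ring_nf
    simp only [I_sq]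
    ring
  · intro hβ
    rw [rho_two_eq hω hβ, (elem_eq hβ).2.2]
    ring
  · intro hβ
    rw [hβ, rho_neg_one_two hω, rpow_half_add hω 3 (by norm_num : (5 / 2 : ℝ) = _)]
    generalize decayIntegral _ = D
    field_simp
    ring
  · intro h1 hβ
    have hr : ((ω ^ (-(3 / 2) : ℝ) : ℝ) : ℂ) = ((ω ^ (-(1 / 2) : ℝ) : ℝ) : ℂ) * (ω : ℂ)⁻¹ := by
      rw [show (-(3 / 2) : ℝ) = -(1 / 2) + -1 by norm_num, Real.rpow_add hω, Real.rpow_neg_one]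
      push_cast
      ring
    rw [rho_three_eq hω hβ, (elem_eq_of_ne h1 hβ).2.2.2, hr]
    ring
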